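/- Conventions. On $\mathbb{R}^n$ ($n\ge 2$) with standard basis $k=e_1,\ l=e_2,\ m_1=e_3,\dots,m_{n-2}=e_n$ and dual basis $\omega^i$ let $\eta=\omega^1\otimes\omega^2+\omega^2\otimes\omega^1+\sum_{i\ge 3}\omega^i\otimes\omega^i$, and let $GN\subset GL(n,\mathbb{R})$ be the group of all $f$ such that $f(k)\in\mathbb{R}k$, $\eta(f(w),f(w'))=\eta(w,w')$ for all $w,w'\in k^\perp$, and $\eta(f(k),f(z))=\eta(k,z)$ for all $z\in\mathbb{R}^n$. A $GN$-structure on an $n$-manifold $M$ is a smooth principal subbundle $P$ of the frame bundle of $M$ with structure group $GN$, frames at $x$ being linear isomorphisms $u:\mathbb{R}^n\to T_xM$. It determines the distributions $\lambda_x=u(\mathbb{R}k)$ and $\Lambda_x=u(k^\perp)$, for $u\in P_x$. An automorphism of $P$ is a diffeomorphism whose differential maps frames in $P$ to frames in $P$, and a (local) vector field is an infinitesimal automorphism if its (local) flow has this property. $P$ is a Kundt structure if 1. $\Lambda$ is integrable, that is, the Lie bracket of any two local smooth sections of $\Lambda$ is again a section of $\Lambda$, and 2. about each point of $M$ there is a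 nowhere vanishing smooth local vector field belonging to $\lambda$ which is an infinitesimal automorphism of $P$. A $GN$-structure on a Lie group is left-invariant if all left multiplications are automorphisms of it. Statement. The Lie algebra $\mathfrak{su}(2)$ has no subalgebra of codimension $1$. Let $G$ be a 3-dimensional real Lie group with Lie algebra $\mathfrak{g}$. - If $\mathfrak{g}$ is not isomorphic to $\mathfrak{su}(2)$, then $\mathfrak{g}$ has a subalgebra of codimension $1$, and $G$ admits a left-invariant Kundt structure. - If $\mathfrak{g}$ is isomorphic to $\mathfrak{su}(2)$, then $G$ admits no left-invariant Kundt structure. -/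

import Mathlib

open scoped Manifold ContDiff Matrix

section SpecialUnitary

attribute [local instance 100] LieRing.ofAssociativeRing

/-- The Lie algebra `𝔰𝔲(2)`: traceless skew-Hermitian complex `2 × 2` matrices, a real Lie algebra
under the commutator. -/
def su2 : LieSubalgebra ℝ (Matrix (Fin 2) (Fin 2) ℂ) where
  carrier := {A | Aᴴ = -A ∧ A.trace = 0}
  add_mem' := by
    rintro A B ⟨hA, hA'⟩ ⟨hB, hB'⟩
    exact ⟨by rw [Matrix.conjTranspose_add, hA, hB, neg_add], by
      rw [Matrix.trace_add, hA', hB', add_zero]⟩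
  zero_mem' := ⟨by simp, by simp⟩
  smul_mem' := by
    rintro c A ⟨hA, hA'⟩
    exact ⟨by rw [Matrix.conjTranspose_smul, hA, star_trivial, smul_neg], by
      rw [Matrix.trace_smul, hA', smul_zero]⟩
  lie_mem' := by
    rintro A B ⟨hA, -⟩ ⟨hB, -⟩
    refine ⟨?_, ?_⟩
    · rw [Ring.lie_def, Matrix.conjTranspose_sub, Matrix.conjTranspose_mul,
        Matrix.conjTranspose_mul, hA, hB]
      noncomm_ring
    · rw [Ring.lie_def, Matrix.trace_sub, Matrix.trace_mul_comm, sub_self]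

end SpecialUnitary

/-- A smooth Lie group has the regularity needed for Mathlib's Lie algebra structure on the tangent
space at the identity. -/
instance lieGroup_minSmoothness_three {E : Type*} [NormedAddCommGroup E] [NormedSpace ℝ E]
    {H : Type*} [TopologicalSpace H] {I : ModelWithCorners ℝ E H} {G : Type*} [TopologicalSpace G]
    [ChartedSpace H G] [Group G] [LieGroup I ∞ G] : LieGroup I (minSmoothness ℝ 3) G := by
  rw [minSmoothness_of_isRCLikeNormedField]
  infer_instance

namespace KundtStructures

/-- The space `ℝⁿ`, `n = m + 2`, with standard basis `k = e₀, l = e₁, m₁ = e₂, …`. -/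
abbrev Space (m : ℕ) : Type := EuclideanSpace ℝ (Fin (m + 2))

/-- The Minkowski inner product
`η = ω¹ ⊗ ω² + ω² ⊗ ω¹ + ω³ ⊗ ω³ + ⋯ + ωⁿ ⊗ ωⁿ`. -/
def eta {m : ℕ} (v w : Space m) : ℝ :=
  v 0 * w 1 + v 1 * w 0 + ∑ i : Fin m, v i.succ.succ * w i.succ.succ

/-- The null vector `k`, the first vector of the standard basis. -/
noncomputable def kVec (m : ℕ) : Space m := EuclideanSpace.single 0 1

theorem eta_kVec {m : ℕ} (w : Space m) : eta (kVec m) w = w 1 := by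
  simp [eta, kVec, Fin.ext_iff]

theorem eta_smul_left {m : ℕ} (c : ℝ) (v w : Space m) : eta (c • v) w = c * eta v w := by
  simp only [eta, PiLp.smul_apply, smul_eq_mul, mul_add, Finset.mul_sum, mul_assoc]

/-- The defining conditions of the group `GN`. -/
def IsGN {m : ℕ} (f : Space m ≃L[ℝ] Space m) : Prop :=
  (∃ c : ℝ, f (kVec m) = c • kVec m) ∧
  (∀ w w' : Space m, eta (kVec m) w = 0 → eta (kVec m) w' = 0 → eta (f w) (f w') = eta w w') ∧
  (∀ z : Space m, eta (f (kVec m)) (f z) = eta (kVec m) z)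

theorem IsGN.exists_scale {m : ℕ} {f : Space m ≃L[ℝ] Space m} (hf : IsGN f) :
    ∃ c : ℝ, c ≠ 0 ∧ f (kVec m) = c • kVec m ∧
      ∀ z, c * eta (kVec m) (f z) = eta (kVec m) z := by
  obtain ⟨⟨c, hc⟩, -, h3⟩ := hf
  have h4 : ∀ z, c * eta (kVec m) (f z) = eta (kVec m) z := fun z => by
    rw [← eta_smul_left, ← hc, h3]
  refine ⟨c, ?_, hc, h4⟩
  rintro rfl
  have := h4 (EuclideanSpace.single 1 1)
  simp [eta_kVec] at this

/-- The group `GN` of invertible linear maps `f` of `ℝⁿ` with `f(k) ∈ ℝk`,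
`η(f(w), f(w')) = η(w, w')` for `w, w' ∈ k^⊥`, and `η(f(k), f(z)) = η(k, z)` for all `z`. -/
def GN (m : ℕ) : Subgroup (Space m ≃L[ℝ] Space m) where
  carrier := {f | IsGN f}
  one_mem' := ⟨⟨1, (one_smul ℝ (kVec m)).symm⟩, fun _ _ _ _ => rfl, fun _ => rfl⟩
  mul_mem' := by
    intro f g hf hg
    obtain ⟨a, ha, hak, haz⟩ := hf.exists_scale
    obtain ⟨b, hb, hbk, hbz⟩ := hg.exists_scale
    have key : ∀ w, eta (kVec m) w = 0 → eta (kVec m) (g w) = 0 := fun w hw => by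
      have := hbz w
      rw [hw] at this
      exact (mul_eq_zero.mp this).resolve_left hb
    refine ⟨⟨b * a, ?_⟩, ?_, ?_⟩
    · change f (g (kVec m)) = _
      rw [hbk, map_smul, hak, smul_smul]
    · intro w w' hw hw'
      change eta (f (g w)) (f (g w')) = _
      rw [hf.2.1 _ _ (key w hw) (key w' hw'), hg.2.1 _ _ hw hw']
    · intro z
      change eta (f (g (kVec m))) (f (g z)) = _
      rw [hbk, map_smul, eta_smul_left, hf.2.2, hbz]
  inv_mem' := by
    intro f hf
    obtain ⟨a, ha, hak, haz⟩ := hf.exists_scale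
    have hi : ∀ v, f (f⁻¹ v) = v := fun v => f.apply_symm_apply v
    have hk : f⁻¹ (kVec m) = a⁻¹ • kVec m := by
      apply f.injective
      rw [hi, map_smul, hak, smul_smul, inv_mul_cancel₀ ha, one_smul]
    have hz : ∀ z, eta (kVec m) (f⁻¹ z) = a * eta (kVec m) z := fun z => by
      rw [← haz (f⁻¹ z), hi]
    refine ⟨⟨a⁻¹, hk⟩, ?_, ?_⟩
    · intro w w' hw hw'
      rw [← hf.2.1 (f⁻¹ w) (f⁻¹ w') (by rw [hz, hw, mul_zero]) (by rw [hz, hw', mul_zero]), hi, hi]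
    · intro z
      rw [hk, eta_smul_left, hz, ← mul_assoc, inv_mul_cancel₀ ha, one_mul]

section Manifold

variable {m : ℕ} {M : Type*} [TopologicalSpace M] [ChartedSpace (Space m) M]
  [IsManifold (𝓡 (m + 2)) ∞ M]

variable (m) in
/-- Frames of the tangent space `T_x M`, as linear isomorphisms `ℝⁿ → T_x M`. -/
abbrev Frame (x : M) : Type := Space m ≃L[ℝ] TangentSpace (𝓡 (m + 2)) x

/-- The vector field `X` (only its values on `U` matter) is smooth on `U`. -/
def SmoothFieldOn (X : (x : M) → TangentSpace (𝓡 (m + 2)) x) (U : Set M) : Prop :=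
  ContMDiffOn (𝓡 (m + 2)) (𝓡 (m + 2)).tangent ∞
    (fun x => (⟨x, X x⟩ : TangentBundle (𝓡 (m + 2)) M)) U

variable (m M) in
/-- A `GN`-structure on an `n`-dimensional manifold, `n = m + 2`: a principal subbundle of the frame
bundle with structure group `GN`. Each fibre is an orbit of the right action of `GN` (nonempty by
the existence of local sections), and there are smooth local sections about each point. -/
structure GNStructure where
  fibre : (x : M) → Set (Frame m x)
  mem_fibre_iff : ∀ (x : M), ∀ u ∈ fibre x, ∀ u' : Frame m x,
    u' ∈ fibre x ↔ ∃ a ∈ GN m, ∀ v, u' v = u (a v)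
  exists_section : ∀ p : M, ∃ U : Set M, IsOpen U ∧ p ∈ U ∧ ∃ s : (x : M) → Frame m x,
    (∀ x ∈ U, s x ∈ fibre x) ∧ ∀ v : Space m, SmoothFieldOn (fun x => s x v) U

namespace GNStructure

variable (P : GNStructure m M)

/-- The one-dimensional distribution `λ_x = u(ℝk)`, `u ∈ P_x`. -/
def nullLine (x : M) : Set (TangentSpace (𝓡 (m + 2)) x) :=
  {v | ∃ u ∈ P.fibre x, ∃ c : ℝ, v = u (c • kVec m)}

/-- The codimension-one distribution `Λ_x = u(k^⊥)`, `u ∈ P_x`. -/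
def nullPerp (x : M) : Set (TangentSpace (𝓡 (m + 2)) x) :=
  {v | ∃ u ∈ P.fibre x, ∃ w : Space m, eta (kVec m) w = 0 ∧ v = u w}

/-- The differential of `φ` at `x` maps the frames in `P_x` to frames in `P_{φ(x)}`. -/
def MapsFibre (φ : M → M) (x : M) : Prop :=
  ∀ u ∈ P.fibre x, ∃ u' ∈ P.fibre (φ x),
    ∀ v, u' v = mfderiv (𝓡 (m + 2)) (𝓡 (m + 2)) φ x (u v)

/-- `Λ` is integrable: the Lie bracket of two local smooth sections of `Λ` is a section of `Λ`. -/
def IsIntegrable : Prop :=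
  ∀ U : Set M, IsOpen U → ∀ X Y : (x : M) → TangentSpace (𝓡 (m + 2)) x,
    SmoothFieldOn X U → SmoothFieldOn Y U →
    (∀ x ∈ U, X x ∈ P.nullPerp x) → (∀ x ∈ U, Y x ∈ P.nullPerp x) →
    ∀ x ∈ U, VectorField.mlieBracket (𝓡 (m + 2)) X Y x ∈ P.nullPerp x

/-- `Φ` is a local flow of the vector field `X` on `U`, defined on `(-ε, ε) × V`. -/
structure IsLocalFlow (X : (x : M) → TangentSpace (𝓡 (m + 2)) x) (U V : Set M) (ε : ℝ)
    (Φ : ℝ → M → M) : Prop where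
  isOpen : IsOpen V
  pos : 0 < ε
  zero : ∀ x ∈ V, Φ 0 x = x
  mapsTo : ∀ t ∈ Set.Ioo (-ε) ε, ∀ x ∈ V, Φ t x ∈ U
  integralCurve : ∀ x ∈ V, IsMIntegralCurveOn (fun t => Φ t x) X (Set.Ioo (-ε) ε)

/-- The vector field `X` on the open set `U` is an infinitesimal automorphism of `P` over `U`:
its local flow about each point of `U` maps frames in `P` to frames in `P`. The first clause asks
for local flows about each point (for smooth `X` it holds automatically), the second
one says that every local flow of `X` in `U` preserves `P`. -/
def IsInfinitesimalAutomorphismOn (X : (x : M) → TangentSpace (𝓡 (m + 2)) x) (U : Set M) : Prop :=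
  (∀ p ∈ U, ∃ (V : Set M) (ε : ℝ) (Φ : ℝ → M → M), p ∈ V ∧ IsLocalFlow X U V ε Φ) ∧
  ∀ (V : Set M) (ε : ℝ) (Φ : ℝ → M → M), IsLocalFlow X U V ε Φ →
    ∀ t ∈ Set.Ioo (-ε) ε, ∀ x ∈ V, P.MapsFibre (Φ t) x

/-- `P` is a Kundt structure: `Λ` is integrable, and about each point there is a nowhere vanishing
local smooth vector field belonging to `λ` which is an infinitesimal automorphism of `P`. -/
def IsKundt : Prop :=
  P.IsIntegrable ∧
  ∀ p : M, ∃ U : Set M, IsOpen U ∧ p ∈ U ∧ ∃ X : (x : M) → TangentSpace (𝓡 (m + 2)) x,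
    SmoothFieldOn X U ∧ (∀ x ∈ U, X x ∈ P.nullLine x ∧ X x ≠ 0) ∧
    P.IsInfinitesimalAutomorphismOn X U

end GNStructure

/-- A `GN`-structure on a Lie group is left-invariant if every left multiplication is an
automorphism of it. -/
def GNStructure.IsLeftInvariant {G : Type*} [TopologicalSpace G] [ChartedSpace (Space m) G]
    [Group G] [LieGroup (𝓡 (m + 2)) ∞ G] (P : GNStructure m G) : Prop :=
  ∀ a x : G, P.MapsFibre (fun y => a * y) x

end Manifold

end KundtStructures

/-! Obstruction: if a left-invariant `GN`-structure has integrable Λ, the bracket of two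
left-invariant fields in Λ is again in Λ, so the hyperplane of Λ at the identity is a subalgebra
(`GNStructure.exists_subalgebra_of_isIntegrable`). But 𝔰𝔲(2) is ℝ³ with the cross product, and `v ×
w` is orthogonal to the plane spanned by `v` and `w`, so no plane is closed under the bracket. Only
integrability is needed here.

Existence: it suffices to find a basis `k, l, m` of the Lie algebra with `[k, m] ∈ ℝk` and `[k, l] ∈
⟨k, m⟩` (`IsFlagBasis`). Then `⟨k, m⟩` is a subalgebra, and the left-invariant frames give a
structure with integrable Λ. The flow of the left-invariant field `k` is right translation by its
integral curve `γ` through 1, which acts on left-invariant fields by `Ad(γ(t))⁻¹ = exp(-t ad k)`. As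
`ad k` maps everything to `k^⊥`, maps `k^⊥` to `ℝk` and kills `k`, this lies in `GN`
(`adInvEquiv_mem_GN`).

Flag bases (`exists_flagBasis`): if the trace of `ad` is not identically zero, its kernel is a plane
containing all brackets, and it yields `k` and `m`. In the unimodular case the bracket is the cross
product followed by a symmetric matrix, which is diagonalised: `[f₁,f₂] = p f₀`, `[f₂,f₀] = q f₁`,
`[f₀,f₁] = r f₂`. A vanishing coefficient or two of opposite signs give explicit flag bases; if all
three have the same sign, rescaling gives 𝔰𝔲(2). -/

/-! ### Left and right trivialisations of the tangent bundle of a Lie group -/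

namespace LieGroupTrivialization

open Bundle VectorField Filter
open scoped Topology

variable {E : Type*} [NormedAddCommGroup E] [NormedSpace ℝ E]
  {G : Type*} [TopologicalSpace G] [ChartedSpace E G]

/-- The derivative of a map between manifolds modelled on `E`, as an endomorphism of `E`. -/
noncomputable def modelDeriv {M N : Type*} [TopologicalSpace M] [ChartedSpace E M]
    [TopologicalSpace N] [ChartedSpace E N] (f : M → N) (x : M) : E →L[ℝ] E :=
  mfderiv 𝓘(ℝ, E) 𝓘(ℝ, E) f x

theorem modelDeriv_comp {M N K : Type*} [TopologicalSpace M] [ChartedSpace E M]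
    [TopologicalSpace N] [ChartedSpace E N] [TopologicalSpace K] [ChartedSpace E K]
    {f : N → K} {g : M → N} {x : M}
    (hf : MDifferentiableAt 𝓘(ℝ, E) 𝓘(ℝ, E) f (g x))
    (hg : MDifferentiableAt 𝓘(ℝ, E) 𝓘(ℝ, E) g x) :
    modelDeriv (E := E) (fun y => f (g y)) x =
      (modelDeriv f (g x)).comp (modelDeriv g x) :=
  mfderiv_comp (I' := 𝓘(ℝ, E)) x hf hg

theorem modelDeriv_id (x : G) : modelDeriv (E := E) (fun y : G => y) x =
    ContinuousLinearMap.id ℝ E :=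
  mfderiv_id

theorem tangentBundle_mk_congr {a b : G} (h : a = b) {v w : E} (hvw : v = w) :
    (⟨a, v⟩ : TangentBundle 𝓘(ℝ, E) G) = ⟨b, w⟩ := by
  subst h hvw
  rfl

variable [Group G]

theorem modelDeriv_one_mul (x : G) :
    modelDeriv (E := E) (fun y => 1 * y) x = ContinuousLinearMap.id ℝ E := by
  simp only [one_mul, modelDeriv_id]

variable [LieGroup 𝓘(ℝ, E) ∞ G]

theorem mdifferentiableAt_mul_left (a x : G) :
    MDifferentiableAt 𝓘(ℝ, E) 𝓘(ℝ, E) (fun y : G => a * y) x :=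
  (contMDiff_mul_left (I := 𝓘(ℝ, E)) (n := ∞)).contMDiffAt.mdifferentiableAt (by simp)

theorem mdifferentiableAt_mul_right (a x : G) :
    MDifferentiableAt 𝓘(ℝ, E) 𝓘(ℝ, E) (fun y : G => y * a) x :=
  (contMDiff_mul_right (I := 𝓘(ℝ, E)) (n := ∞)).contMDiffAt.mdifferentiableAt (by simp)

theorem modelDeriv_mul_left_comp (a b x : G) :
    (modelDeriv (E := E) (fun y => a * y) (b * x)).comp (modelDeriv (fun y => b * y) x) =
      modelDeriv (fun y => a * b * y) x := by
  rw [← modelDeriv_comp (mdifferentiableAt_mul_left _ _) (mdifferentiableAt_mul_left _ _)]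
  simp only [mul_assoc]

theorem modelDeriv_mul_right_comp (a b x : G) :
    (modelDeriv (E := E) (fun y => y * b) (x * a)).comp (modelDeriv (fun y => y * a) x) =
      modelDeriv (fun y => y * (a * b)) x := by
  rw [← modelDeriv_comp (mdifferentiableAt_mul_right _ _) (mdifferentiableAt_mul_right _ _)]
  simp only [mul_assoc]

theorem modelDeriv_mul_left_mul_right_comm (a b x : G) :
    (modelDeriv (E := E) (fun y => y * b) (a * x)).comp (modelDeriv (fun y => a * y) x) =
      (modelDeriv (fun y => a * y) (x * b)).comp (modelDeriv (fun y => y * b) x) := by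
  rw [← modelDeriv_comp (mdifferentiableAt_mul_right _ _) (mdifferentiableAt_mul_left _ _),
    ← modelDeriv_comp (mdifferentiableAt_mul_left _ _) (mdifferentiableAt_mul_right _ _)]
  simp only [mul_assoc]

/-- The left-invariant trivialisation of the tangent bundle. -/
noncomputable def leftEquiv (x : G) : E ≃L[ℝ] E :=
  ContinuousLinearEquiv.equivOfInverse
    (modelDeriv (fun y : G => x * y) 1) (modelDeriv (fun y : G => x⁻¹ * y) x)
    (fun v => by
      have := modelDeriv_mul_left_comp (E := E) x⁻¹ x 1
      rw [mul_one, inv_mul_cancel, modelDeriv_one_mul] at this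
      exact DFunLike.congr_fun this v)
    (fun v => by
      have := modelDeriv_mul_left_comp (E := E) x x⁻¹ x
      rw [inv_mul_cancel, mul_inv_cancel, modelDeriv_one_mul] at this
      exact DFunLike.congr_fun this v)

theorem leftEquiv_apply (x : G) (v : E) :
    leftEquiv x v = modelDeriv (fun y : G => x * y) 1 v := rfl

theorem leftEquiv_symm_apply (x : G) (v : E) :
    (leftEquiv x).symm v = modelDeriv (fun y : G => x⁻¹ * y) x v := rfl

theorem leftEquiv_one : leftEquiv (1 : G) = ContinuousLinearEquiv.refl ℝ E := by
  ext v
  rw [leftEquiv_apply, modelDeriv_one_mul]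
  rfl

theorem modelDeriv_mul_left_leftEquiv (a x : G) (v : E) :
    modelDeriv (fun y : G => a * y) x (leftEquiv x v) = leftEquiv (a * x) v := by
  have := DFunLike.congr_fun (modelDeriv_mul_left_comp (E := E) a x 1) v
  rwa [mul_one] at this

/-- The adjoint action of `g⁻¹` on the Lie algebra. -/
noncomputable def adInv (g : G) (v : E) : E :=
  (leftEquiv g).symm (modelDeriv (fun y : G => y * g) 1 v)

theorem leftEquiv_adInv (g : G) (v : E) :
    leftEquiv g (adInv g v) = modelDeriv (fun y : G => y * g) 1 v :=
  (leftEquiv g).apply_symm_apply _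

theorem adInv_one (v : E) : adInv (1 : G) v = v := by
  rw [adInv, leftEquiv_one]
  simp only [mul_one, modelDeriv_id]
  rfl

/-- Left and right translations commute, so in the left trivialisation a right translation acts by
the same linear map at every point. -/
theorem modelDeriv_mul_right_leftEquiv (x g : G) (v : E) :
    modelDeriv (fun y : G => y * g) x (leftEquiv x v) = leftEquiv (x * g) (adInv g v) := by
  have := DFunLike.congr_fun (modelDeriv_mul_left_mul_right_comm (E := E) x g 1) v
  simp only [mul_one, one_mul, ContinuousLinearMap.comp_apply] at this
  rw [← leftEquiv_adInv, modelDeriv_mul_left_leftEquiv] at this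
  exact this

theorem adInv_mul (g h : G) (v : E) : adInv (g * h) v = adInv h (adInv g v) := by
  apply (leftEquiv (g * h)).injective
  rw [← modelDeriv_mul_right_leftEquiv, leftEquiv_adInv, leftEquiv_adInv,
    ← modelDeriv_mul_right_comp (E := E) g h 1, one_mul]
  rfl

/-! ### Smoothness -/

/-- The tangent map of multiplication is smooth on `T(G × G) ≅ TG × TG`, and the product rule splits
it into its two partial derivatives. Inserting a zero or a constant vector in one slot gives the
smoothness of invariant fields and of left coordinates. -/
theorem contMDiffAt_mul_tangent {M : Type*} [TopologicalSpace M]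
    {E' : Type*} [NormedAddCommGroup E']
    [NormedSpace ℝ E'] [ChartedSpace E' M] {n : ℕ∞ω} (hn : n + 1 ≤ ∞) {x : M}
    {a b : M → G} {v w : M → E}
    (hv : ContMDiffAt 𝓘(ℝ, E') 𝓘(ℝ, E).tangent n
      (fun y => (⟨a y, v y⟩ : TangentBundle 𝓘(ℝ, E) G)) x)
    (hw : ContMDiffAt 𝓘(ℝ, E') 𝓘(ℝ, E).tangent n
      (fun y => (⟨b y, w y⟩ : TangentBundle 𝓘(ℝ, E) G)) x) :
    ContMDiffAt 𝓘(ℝ, E') 𝓘(ℝ, E).tangent n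
      (fun y => (⟨a y * b y, modelDeriv (fun z => z * b y) (a y) (v y) +
        modelDeriv (fun z => a y * z) (b y) (w y)⟩ : TangentBundle 𝓘(ℝ, E) G)) x := by
  have S₂ : ContMDiff (𝓘(ℝ, E).tangent.prod 𝓘(ℝ, E).tangent) (𝓘(ℝ, E).prod 𝓘(ℝ, E)).tangent n
    (equivTangentBundleProd 𝓘(ℝ, E) G 𝓘(ℝ, E) G).symm := contMDiff_equivTangentBundleProd_symm
  let F₃ : TangentBundle (𝓘(ℝ, E).prod 𝓘(ℝ, E)) (G × G) → TangentBundle 𝓘(ℝ, E) G :=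
    tangentMap (𝓘(ℝ, E).prod 𝓘(ℝ, E)) 𝓘(ℝ, E) (fun (p : G × G) ↦ p.1 * p.2)
  have S₃ : ContMDiff (𝓘(ℝ, E).prod 𝓘(ℝ, E)).tangent 𝓘(ℝ, E).tangent n F₃ :=
    ContMDiff.contMDiff_tangentMap ((contMDiff_mul 𝓘(ℝ, E) ∞).of_le hn) le_rfl
  have := (S₃.comp S₂).contMDiffAt.comp x (hv.prodMk hw)
  convert! this using 2 with y
  refine congrArg (TotalSpace.mk (a y * b y)) ?_
  exact (mfderiv_prod_eq_add_apply (I := 𝓘(ℝ, E)) (I' := 𝓘(ℝ, E)) (I'' := 𝓘(ℝ, E))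
    (f := fun p : G × G => p.1 * p.2) (p := (a y, b y)) (v := (v y, w y))
    ((contMDiff_mul 𝓘(ℝ, E) ∞).contMDiffAt.mdifferentiableAt (by simp))).symm

theorem contMDiff_zero_tangent (n : ℕ∞ω) :
    ContMDiff 𝓘(ℝ, E) 𝓘(ℝ, E).tangent n (fun x : G => (⟨x, (0 : E)⟩ : TangentBundle 𝓘(ℝ, E) G)) :=
  contMDiff_zeroSection _ _

theorem contMDiff_leftEquiv (v : E) :
    ContMDiff 𝓘(ℝ, E) 𝓘(ℝ, E).tangent ∞
      (fun x : G => (⟨x, leftEquiv (E := E) x v⟩ : TangentBundle 𝓘(ℝ, E) G)) := fun x => by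
  have h := contMDiffAt_mul_tangent (n := ∞) (by simp) (a := fun y : G => y) (b := fun _ : G => 1)
    (v := fun _ => (0 : E)) (w := fun _ => v) (x := x)
    (contMDiff_zero_tangent _).contMDiffAt contMDiffAt_const
  refine h.congr_of_eventuallyEq (Eventually.of_forall fun y => ?_)
  exact tangentBundle_mk_congr (mul_one y).symm (by rw [map_zero, zero_add, leftEquiv_apply])

theorem contMDiff_modelDeriv_mul_right (v : E) :
    ContMDiff 𝓘(ℝ, E) 𝓘(ℝ, E).tangent ∞
      (fun x : G => (⟨x, modelDeriv (E := E) (fun y => y * x) 1 v⟩ : TangentBundle 𝓘(ℝ, E) G)) :=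
  fun x => by
  have h := contMDiffAt_mul_tangent (n := ∞) (by simp) (a := fun _ : G => 1) (b := fun y : G => y)
    (v := fun _ => v) (w := fun _ => (0 : E)) (x := x) contMDiffAt_const
    (contMDiff_zero_tangent _).contMDiffAt
  refine h.congr_of_eventuallyEq (Eventually.of_forall fun y => ?_)
  exact tangentBundle_mk_congr (one_mul y).symm (by rw [map_zero, add_zero])

/-- Multiplying the zero vector at `y⁻¹` by `X y` gives a smooth curve of vectors over the single
point `y⁻¹ * y = 1`; its fibre component is the left coordinate of `X`. -/
theorem contMDiffAt_leftEquiv_symm {n : ℕ∞ω} (hn : n + 1 ≤ ∞) {X : G → E} {x : G}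
    (hX : ContMDiffAt 𝓘(ℝ, E) 𝓘(ℝ, E).tangent n
      (fun y => (⟨y, X y⟩ : TangentBundle 𝓘(ℝ, E) G)) x) :
    ContMDiffAt 𝓘(ℝ, E) 𝓘(ℝ, E) n (fun y => (leftEquiv y).symm (X y)) x := by
  have hz : ContMDiffAt 𝓘(ℝ, E) 𝓘(ℝ, E).tangent n
      (fun y : G => (⟨y⁻¹, (0 : E)⟩ : TangentBundle 𝓘(ℝ, E) G)) x :=
    (contMDiff_zero_tangent _).contMDiffAt.comp x
      (((contMDiff_inv 𝓘(ℝ, E) ∞).of_le (le_trans le_self_add hn)).contMDiffAt)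
  have h := contMDiffAt_mul_tangent hn hz hX
  have h2 := (contMDiffAt_totalSpace.1 h).2
  refine h2.congr_of_eventuallyEq (Eventually.of_forall fun y => ?_)
  -- The base point is 1 only propositionally, so the change of coordinates is first shown trivial
  -- over a variable point equal to 1.
  have key : ∀ (z : G) (u : E), z = 1 → tangentCoordChange 𝓘(ℝ, E) z (x⁻¹ * x) z u = u := by
    rintro z u rfl
    rw [inv_mul_cancel]
    exact tangentCoordChange_self (mem_extChartAt_source _)
  have h3 := key (y⁻¹ * y)
    (modelDeriv (fun z => z * y) y⁻¹ 0 + modelDeriv (fun z => y⁻¹ * z) y (X y))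
    (inv_mul_cancel y)
  have h4 : (leftEquiv y).symm (X y) =
      modelDeriv (fun z => z * y) y⁻¹ (0 : E) + modelDeriv (fun z => y⁻¹ * z) y (X y) := by
    rw [map_zero, zero_add, leftEquiv_symm_apply]
  exact h4.trans h3.symm

end LieGroupTrivialization

/-! ### Commutation of left- and right-invariant fields at the identity -/

namespace LieGroupTrivialization

open Bundle VectorField Filter
open scoped Topology

variable {E : Type*} [NormedAddCommGroup E] [NormedSpace ℝ E]

/-- The Lie bracket of vector fields on a manifold modelled on `E`, as a function into `E`. -/
noncomputable def modelBracket {M : Type*} [TopologicalSpace M] [ChartedSpace E M]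
    (X Y : M → E) : M → E :=
  mlieBracket 𝓘(ℝ, E) X Y

section Bracket

variable (G : Type*) [TopologicalSpace G] [ChartedSpace E G] [Group G]

/-- The multiplication of `G` in the chart at the identity. -/
noncomputable def chartMul (p : E × E) : E :=
  extChartAt 𝓘(ℝ, E) (1 : G)
    ((extChartAt 𝓘(ℝ, E) (1 : G)).symm p.1 * (extChartAt 𝓘(ℝ, E) (1 : G)).symm p.2)

/-- A vector field in the chart at the identity. -/
noncomputable def chartField (X : G → E) : E → E :=
  mpullbackWithin 𝓘(ℝ, E) 𝓘(ℝ, E) (extChartAt 𝓘(ℝ, E) (1 : G)).symm X (Set.range 𝓘(ℝ, E))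

theorem modelBracket_one_eq_zero {X Y : G → E}
    (h : lieBracket ℝ (chartField G X) (chartField G Y) (extChartAt 𝓘(ℝ, E) (1 : G) 1) = 0) :
    modelBracket (E := E) X Y 1 = 0 := by
  have hset : (extChartAt 𝓘(ℝ, E) (1 : G)).symm ⁻¹' Set.univ ∩ Set.range 𝓘(ℝ, E) = Set.univ := by
    simp
  have h1 : lieBracketWithin ℝ (chartField G X) (chartField G Y)
      ((extChartAt 𝓘(ℝ, E) (1 : G)).symm ⁻¹' Set.univ ∩ Set.range 𝓘(ℝ, E))
      (extChartAt 𝓘(ℝ, E) (1 : G) 1) = 0 := by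
    rw [hset, lieBracketWithin_univ, h]
  have h2 := mlieBracketWithin_apply (I := 𝓘(ℝ, E)) (V := X) (W := Y)
    (s := Set.univ) (x₀ := (1 : G))
  have h3 := congrFun (mlieBracketWithin_univ (I := 𝓘(ℝ, E)) (V := X) (W := Y)) (1 : G)
  exact h3.symm.trans (h2.trans ((congrArg _ h1).trans (map_zero _)))

variable [LieGroup 𝓘(ℝ, E) ∞ G]

theorem contDiffAt_chartMul :
    ContDiffAt ℝ ∞ (chartMul G)
      (extChartAt 𝓘(ℝ, E) (1 : G) 1, extChartAt 𝓘(ℝ, E) (1 : G) 1) := by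
  have hs : ContMDiffAt 𝓘(ℝ, E) 𝓘(ℝ, E) ∞ (extChartAt 𝓘(ℝ, E) (1 : G)).symm
      (extChartAt 𝓘(ℝ, E) (1 : G) 1) :=
    (contMDiffOn_extChartAt_symm (1 : G)).contMDiffAt (extChartAt_target_mem_nhds (1 : G))
  rw [← contMDiffAt_iff_contDiffAt]
  have h1 : ContMDiffAt 𝓘(ℝ, E × E) 𝓘(ℝ, E) ∞
      (fun p : E × E => (extChartAt 𝓘(ℝ, E) (1 : G)).symm p.1)
      (extChartAt 𝓘(ℝ, E) (1 : G) 1, extChartAt 𝓘(ℝ, E) (1 : G) 1) :=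
    ContMDiffAt.comp (I' := 𝓘(ℝ, E)) (g := (extChartAt 𝓘(ℝ, E) (1 : G)).symm)
      (f := fun p : E × E => p.1) _ hs contDiff_fst.contMDiff.contMDiffAt
  have h2 : ContMDiffAt 𝓘(ℝ, E × E) 𝓘(ℝ, E) ∞
      (fun p : E × E => (extChartAt 𝓘(ℝ, E) (1 : G)).symm p.2)
      (extChartAt 𝓘(ℝ, E) (1 : G) 1, extChartAt 𝓘(ℝ, E) (1 : G) 1) :=
    ContMDiffAt.comp (I' := 𝓘(ℝ, E)) (g := (extChartAt 𝓘(ℝ, E) (1 : G)).symm)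
      (f := fun p : E × E => p.2) _ hs contDiff_snd.contMDiff.contMDiffAt
  have h3 := h1.mul h2
  refine ContMDiffAt.comp (I' := 𝓘(ℝ, E)) (g := extChartAt 𝓘(ℝ, E) (1 : G)) _ ?_ h3
  have : (extChartAt 𝓘(ℝ, E) (1 : G)).symm (extChartAt 𝓘(ℝ, E) (1 : G) 1) *
      (extChartAt 𝓘(ℝ, E) (1 : G)).symm (extChartAt 𝓘(ℝ, E) (1 : G) 1) = (1 : G) := by simp
  rw [this]
  exact contMDiffAt_extChartAt

theorem modelDeriv_extChartAt_symm :
    modelDeriv (extChartAt 𝓘(ℝ, E) (1 : G)).symm (extChartAt 𝓘(ℝ, E) (1 : G) 1) =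
      ContinuousLinearMap.id ℝ E := by
  have := mfderivWithin_range_extChartAt_symm (I := 𝓘(ℝ, E)) (x := (1 : G))
  rw [ModelWithCorners.Boundaryless.range_eq_univ, mfderivWithin_univ] at this
  exact this

theorem chartField_apply {y : E} (hy : y ∈ (extChartAt 𝓘(ℝ, E) (1 : G)).target) (X : G → E) :
    chartField G X y =
      modelDeriv (extChartAt 𝓘(ℝ, E) (1 : G)) ((extChartAt 𝓘(ℝ, E) (1 : G)).symm y)
        (X ((extChartAt 𝓘(ℝ, E) (1 : G)).symm y)) :=
  DFunLike.congr_fun (ContinuousLinearMap.inverse_eq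
    (mfderivWithin_extChartAt_symm_comp_mfderiv_extChartAt (I := 𝓘(ℝ, E)) hy)
    (mfderiv_extChartAt_comp_mfderivWithin_extChartAt_symm (I := 𝓘(ℝ, E)) hy)) _

theorem modelDeriv_extChartAt_apply {f : G → G} (hf : MDifferentiableAt 𝓘(ℝ, E) 𝓘(ℝ, E) f 1)
    (h1 : f 1 ∈ (extChartAt 𝓘(ℝ, E) (1 : G)).source) (v : E) :
    modelDeriv (extChartAt 𝓘(ℝ, E) (1 : G)) (f 1) (modelDeriv f 1 v) =
      fderiv ℝ (fun z => extChartAt 𝓘(ℝ, E) (1 : G) (f ((extChartAt 𝓘(ℝ, E) (1 : G)).symm z)))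
        (extChartAt 𝓘(ℝ, E) (1 : G) 1) v := by
  have hs : MDifferentiableAt 𝓘(ℝ, E) 𝓘(ℝ, E) (extChartAt 𝓘(ℝ, E) (1 : G)).symm
      (extChartAt 𝓘(ℝ, E) (1 : G) 1) :=
    ((contMDiffOn_extChartAt_symm (n := ∞) (1 : G)).contMDiffAt
      (extChartAt_target_mem_nhds (1 : G))).mdifferentiableAt (by simp)
  have e1 : (extChartAt 𝓘(ℝ, E) (1 : G)).symm (extChartAt 𝓘(ℝ, E) (1 : G) 1) = 1 := by simp
  have hf' : MDifferentiableAt 𝓘(ℝ, E) 𝓘(ℝ, E) f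
      ((extChartAt 𝓘(ℝ, E) (1 : G)).symm (extChartAt 𝓘(ℝ, E) (1 : G) 1)) := by rwa [e1]
  have hφ : MDifferentiableAt 𝓘(ℝ, E) 𝓘(ℝ, E) (extChartAt 𝓘(ℝ, E) (1 : G)) (f 1) :=
    mdifferentiableAt_extChartAt (by rwa [← extChartAt_source 𝓘(ℝ, E)])
  have h2 := modelDeriv_comp (E := E) hf' hs
  have h3 := modelDeriv_comp (E := E)
    (g := fun z => f ((extChartAt 𝓘(ℝ, E) (1 : G)).symm z)) (by rwa [e1]) (hf'.comp _ hs)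
  rw [h2, e1, modelDeriv_extChartAt_symm] at h3
  have h4 := DFunLike.congr_fun h3 v
  refine Eq.trans h4.symm ?_
  rw [modelDeriv, mfderiv_eq_fderiv]

/-- In the chart, with `μ` the multiplication and `o` the image of 1, the fields are `Dμ(y, o)(0,
v)` and `Dμ(o, y)(w, 0)`. Their bracket at `o` is the difference of the two mixed second derivatives
of `μ`, zero by symmetry. -/
theorem modelBracket_leftEquiv_modelDeriv_mul_right (v w : E) :
    modelBracket (fun x : G => leftEquiv x v) (fun x : G => modelDeriv (fun y => y * x) 1 w) 1 =
      (0 : E) := by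
  set o : E := extChartAt 𝓘(ℝ, E) (1 : G) 1 with ho
  have hm := contDiffAt_chartMul (E := E) G
  rw [← ho] at hm
  have hdiff : ∀ᶠ p in 𝓝 (o, o), DifferentiableAt ℝ (chartMul (E := E) G) p :=
    ((hm.of_le (n := ∞) (m := 1) (by simp)).eventually (by simp)).mono
      fun p hp => hp.differentiableAt (by simp)
  have hdd : DifferentiableAt ℝ (fderiv ℝ (chartMul (E := E) G)) (o, o) :=
    (hm.fderiv_right (m := 1) (by norm_cast)).differentiableAt (by simp)
  have ht : ∀ᶠ y in 𝓝 o, y ∈ (extChartAt 𝓘(ℝ, E) (1 : G)).target :=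
    extChartAt_target_mem_nhds (1 : G)
  have ho1 : (extChartAt 𝓘(ℝ, E) (1 : G)).symm o = 1 := by simp [ho]
  have hl : Tendsto (fun y : E => (y, o)) (𝓝 o) (𝓝 (o, o)) := by
    have : Continuous (fun y : E => (y, o)) := by fun_prop
    exact this.tendsto o
  have hr : Tendsto (fun y : E => (o, y)) (𝓝 o) (𝓝 (o, o)) := by
    have : Continuous (fun y : E => (o, y)) := by fun_prop
    exact this.tendsto o
  have hV : chartField G (fun x => leftEquiv x v) =ᶠ[𝓝 o]
      fun y => fderiv ℝ (chartMul (E := E) G) (y, o) (0, v) := by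
    filter_upwards [ht, hl.eventually hdiff] with y hy hd
    rw [chartField_apply G hy]
    have h1 := modelDeriv_extChartAt_apply G
      (mdifferentiableAt_mul_left (E := E) ((extChartAt 𝓘(ℝ, E) (1 : G)).symm y) 1)
      (by rw [mul_one]; exact (extChartAt 𝓘(ℝ, E) (1 : G)).map_target hy) v
    rw [mul_one] at h1
    refine h1.trans ?_
    have h2 : HasFDerivAt (fun z : E => (y, z)) (ContinuousLinearMap.inr ℝ E E) o :=
      hasFDerivAt_prodMk_right y o
    have h3 := (hd.hasFDerivAt.comp (f := fun z : E => (y, z)) o h2).fderiv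
    exact DFunLike.congr_fun h3 v
  have hW : chartField G (fun x => modelDeriv (fun y => y * x) 1 w) =ᶠ[𝓝 o]
      fun y => fderiv ℝ (chartMul (E := E) G) (o, y) (w, 0) := by
    filter_upwards [ht, hr.eventually hdiff] with y hy hd
    rw [chartField_apply G hy]
    have h1 := modelDeriv_extChartAt_apply G
      (mdifferentiableAt_mul_right (E := E) ((extChartAt 𝓘(ℝ, E) (1 : G)).symm y) 1)
      (by rw [one_mul]; exact (extChartAt 𝓘(ℝ, E) (1 : G)).map_target hy) w
    rw [one_mul] at h1
    refine h1.trans ?_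
    have h2 : HasFDerivAt (fun z : E => (z, y)) (ContinuousLinearMap.inl ℝ E E) o :=
      hasFDerivAt_prodMk_left o y
    have h3 := (hd.hasFDerivAt.comp (f := fun z : E => (z, y)) o h2).fderiv
    exact DFunLike.congr_fun h3 w
  apply modelBracket_one_eq_zero
  rw [← ho, hV.lieBracket_vectorField_eq hW]
  have h1 : HasFDerivAt (fun z : E => (z, o)) (ContinuousLinearMap.inl ℝ E E) o :=
    hasFDerivAt_prodMk_left o o
  have h2 : HasFDerivAt (fun z : E => (o, z)) (ContinuousLinearMap.inr ℝ E E) o :=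
    hasFDerivAt_prodMk_right o o
  have h3 := ((hdd.hasFDerivAt.comp (f := fun z : E => (z, o)) o h1).clm_apply
    (hasFDerivAt_const ((0 : E), v) o)).fderiv
  have h4 := ((hdd.hasFDerivAt.comp (f := fun z : E => (o, z)) o h2).clm_apply
    (hasFDerivAt_const (w, (0 : E)) o)).fderiv
  simp only [Function.comp_apply] at h3 h4
  -- At the identity the chart and both translations have derivative the identity, so the two chart
  -- fields take the values `v` and `w` at `o`.
  have h5 := hV.self_of_nhds
  have h6 := hW.self_of_nhds
  rw [chartField_apply G (mem_extChartAt_target 1), ← ho, ho1] at h5 h6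
  have hid : modelDeriv (extChartAt 𝓘(ℝ, E) (1 : G)) (1 : G) = ContinuousLinearMap.id ℝ E :=
    mfderiv_extChartAt_self
  rw [hid, leftEquiv_one] at h5
  simp only [mul_one, modelDeriv_id, hid] at h6
  simp only [ContinuousLinearMap.id_apply, ContinuousLinearEquiv.refl_apply] at h5 h6
  simp only [lieBracket_eq]
  rw [← h5, ← h6, h3, h4]
  have hsymm := (hm.isSymmSndFDerivAt (by
    rw [minSmoothness_of_isRCLikeNormedField]; exact WithTop.coe_le_coe.2 le_top)) (0, v) (w, 0)
  simpa [sub_eq_zero] using! hsymm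

end Bracket

/-! ### Leibniz rules for the bracket of vector fields -/

section Leibniz

variable {M : Type*} [TopologicalSpace M] [ChartedSpace E M]

/-- The derivative of a real function on a manifold modelled on `E`. -/
noncomputable def scalarDeriv (f : M → ℝ) (x : M) : E →L[ℝ] ℝ :=
  mfderiv 𝓘(ℝ, E) 𝓘(ℝ, ℝ) f x

theorem modelBracket_swap (X Y : M → E) (x : M) : modelBracket X Y x = -modelBracket Y X x :=
  mlieBracket_swap_apply (I := 𝓘(ℝ, E))

theorem modelBracket_zero_right (X : M → E) (x : M) :
    modelBracket X (fun _ => (0 : E)) x = 0 :=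
  congrFun (mlieBracket_zero_right (I := 𝓘(ℝ, E)) (W := X)) x

variable [IsManifold 𝓘(ℝ, E) ∞ M]

/-- The vector field `X` is differentiable at `x`. -/
def DiffFieldAt (X : M → E) (x : M) : Prop :=
  MDifferentiableAt 𝓘(ℝ, E) 𝓘(ℝ, E).tangent
    (fun y => (⟨y, X y⟩ : TangentBundle 𝓘(ℝ, E) M)) x

theorem DiffFieldAt.smul {f : M → ℝ} {X : M → E} {x : M}
    (hf : MDifferentiableAt 𝓘(ℝ, E) 𝓘(ℝ, ℝ) f x) (hX : DiffFieldAt X x) :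
    DiffFieldAt (fun y => f y • X y) x :=
  MDifferentiableAt.smul_section hf hX

theorem DiffFieldAt.add {X Y : M → E} {x : M} (hX : DiffFieldAt X x) (hY : DiffFieldAt Y x) :
    DiffFieldAt (fun y => X y + Y y) x :=
  mdifferentiableAt_add_section hX hY

theorem DiffFieldAt.zero (x : M) : DiffFieldAt (fun _ : M => (0 : E)) x :=
  (mdifferentiable_zeroSection ℝ (TangentSpace 𝓘(ℝ, E) (M := M))) x

theorem DiffFieldAt.sum {ι : Type*} (s : Finset ι) {X : ι → M → E} {x : M}
    (hX : ∀ i, DiffFieldAt (X i) x) : DiffFieldAt (fun y => ∑ i ∈ s, X i y) x := by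
  classical
  induction s using Finset.induction_on with
  | empty => simpa using DiffFieldAt.zero x
  | insert a s ha ih =>
    simp only [Finset.sum_insert ha]
    exact (hX a).add ih

variable [CompleteSpace E]

theorem modelBracket_add_right {X Y Z : M → E} {x : M} (hY : DiffFieldAt Y x)
    (hZ : DiffFieldAt Z x) :
    modelBracket X (fun y => Y y + Z y) x = modelBracket X Y x + modelBracket X Z x :=
  mlieBracket_add_right (I := 𝓘(ℝ, E)) (V := X) hY hZ

theorem modelBracket_smul_right {f : M → ℝ} {X Y : M → E} {x : M}
    (hf : MDifferentiableAt 𝓘(ℝ, E) 𝓘(ℝ, ℝ) f x) (hY : DiffFieldAt Y x) :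
    modelBracket X (fun y => f y • Y y) x =
      scalarDeriv f x (X x) • Y x + f x • modelBracket X Y x :=
  mlieBracket_smul_right (I := 𝓘(ℝ, E)) (V := X) hf hY

theorem modelBracket_sum_smul_right {ι : Type*} (s : Finset ι) {f : ι → M → ℝ} {X : M → E}
    {Y : ι → M → E} {x : M} (hf : ∀ i, MDifferentiableAt 𝓘(ℝ, E) 𝓘(ℝ, ℝ) (f i) x)
    (hY : ∀ i, DiffFieldAt (Y i) x) :
    modelBracket X (fun y => ∑ i ∈ s, f i y • Y i y) x =
      ∑ i ∈ s, (scalarDeriv (f i) x (X x) • Y i x + f i x • modelBracket X (Y i) x) := by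
  classical
  induction s using Finset.induction_on with
  | empty => simpa using modelBracket_zero_right X x
  | insert a s ha ih =>
    simp only [Finset.sum_insert ha]
    rw [modelBracket_add_right ((hY a).smul (hf a)) (DiffFieldAt.sum s fun i => (hY i).smul (hf i)),
      ih, modelBracket_smul_right (hf a) (hY a)]

end Leibniz

/-! ### The bracket in the left trivialisation -/

section Formula

variable {G : Type*} [TopologicalSpace G] [ChartedSpace E G] [Group G] [LieGroup 𝓘(ℝ, E) ∞ G]

theorem diffFieldAt_leftEquiv (v : E) (x : G) : DiffFieldAt (fun y : G => leftEquiv y v) x :=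
  (contMDiff_leftEquiv v).contMDiffAt.mdifferentiableAt (by simp)

variable (G) [CompleteSpace E]

/-- The Lie bracket of the Lie algebra of `G` as a bilinear map on the model space. -/
noncomputable def lieBilin : E →ₗ[ℝ] E →ₗ[ℝ] E :=
  ((LieModule.toEnd ℝ (GroupLieAlgebra 𝓘(ℝ, E) G) (GroupLieAlgebra 𝓘(ℝ, E) G) :
    GroupLieAlgebra 𝓘(ℝ, E) G →ₗ[ℝ] Module.End ℝ (GroupLieAlgebra 𝓘(ℝ, E) G)))

theorem lieBilin_self (v : E) : lieBilin G v v = 0 :=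
  lie_self (L := GroupLieAlgebra 𝓘(ℝ, E) G) v

variable {G}

theorem modelBracket_leftEquiv (v w : E) (x : G) :
    modelBracket (fun y : G => leftEquiv y v) (fun y => leftEquiv y w) x =
      leftEquiv x (lieBilin G v w) :=
  (congrFun (mulInvariantVector_mlieBracket (I := 𝓘(ℝ, E)) (G := G) v w) x).symm

variable [FiniteDimensional ℝ E]

/-- Expand `X` and `Y` in a left-invariant frame and apply the Leibniz rule in each argument: the
coefficients contribute the two derivative terms, the frame fields the algebraic bracket. -/
theorem leftEquiv_symm_modelBracket {X Y : G → E} {x : G}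
    (hξ : MDifferentiableAt 𝓘(ℝ, E) 𝓘(ℝ, E) (fun y => (leftEquiv y).symm (X y)) x)
    (hη : MDifferentiableAt 𝓘(ℝ, E) 𝓘(ℝ, E) (fun y => (leftEquiv y).symm (Y y)) x) :
    (leftEquiv x).symm (modelBracket X Y x) =
      modelDeriv (fun y => (leftEquiv y).symm (Y y)) x (X x) -
        modelDeriv (fun y => (leftEquiv y).symm (X y)) x (Y x) +
        lieBilin G ((leftEquiv x).symm (X x)) ((leftEquiv x).symm (Y x)) := by
  let b := Module.finBasis ℝ E
  have hc : ∀ {ζ : G → E} (_ : MDifferentiableAt 𝓘(ℝ, E) 𝓘(ℝ, E) ζ x) (i),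
      MDifferentiableAt 𝓘(ℝ, E) 𝓘(ℝ, ℝ) (fun y => b.repr (ζ y) i) x ∧
      ∀ v, scalarDeriv (fun y => b.repr (ζ y) i) x v = b.repr (modelDeriv ζ x v) i := by
    intro ζ hζ i
    let c : E →L[ℝ] ℝ := LinearMap.toContinuousLinearMap (b.coord i)
    have h := (c.hasMFDerivAt (x := ζ x)).comp x hζ.hasMFDerivAt
    exact ⟨h.mdifferentiableAt, fun v => DFunLike.congr_fun h.mfderiv v⟩
  have hsum : ∀ Z : G → E,
      Z = fun y => ∑ i, b.repr ((leftEquiv y).symm (Z y)) i • leftEquiv y (b i) := by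
    intro Z
    funext y
    simp only [← map_smul, ← map_sum, b.sum_repr, ContinuousLinearEquiv.apply_symm_apply]
  have h1 : ∀ j, modelBracket X (fun y => leftEquiv y (b j)) x =
      ∑ i, (-(b.repr (modelDeriv (fun y => (leftEquiv y).symm (X y)) x (leftEquiv x (b j))) i) •
        leftEquiv x (b i) +
          b.repr ((leftEquiv x).symm (X x)) i • leftEquiv x (lieBilin G (b i) (b j))) := by
    intro j
    rw [modelBracket_swap]
    conv_lhs => rw [hsum X]
    rw [modelBracket_sum_smul_right _ (fun i => (hc hξ i).1) (fun i => diffFieldAt_leftEquiv _ _),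
      ← Finset.sum_neg_distrib]
    refine Finset.sum_congr rfl fun i _ => ?_
    rw [(hc hξ i).2, modelBracket_swap, modelBracket_leftEquiv]
    module
  have h2 : modelBracket X Y x = ∑ j,
      (b.repr (modelDeriv (fun y => (leftEquiv y).symm (Y y)) x (X x)) j •
        leftEquiv x (b j) + b.repr ((leftEquiv x).symm (Y x)) j •
          modelBracket X (fun y => leftEquiv y (b j)) x) := by
    conv_lhs => rw [hsum Y]
    rw [modelBracket_sum_smul_right _ (fun i => (hc hη i).1) (fun i => diffFieldAt_leftEquiv _ _)]
    exact Finset.sum_congr rfl fun i _ => by rw [(hc hη i).2]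
  have h3 : ∀ j, (leftEquiv x).symm (modelBracket X (fun y => leftEquiv y (b j)) x) =
      -modelDeriv (fun y => (leftEquiv y).symm (X y)) x (leftEquiv x (b j)) +
        lieBilin G ((leftEquiv x).symm (X x)) (b j) := by
    intro j
    simp only [h1, map_sum, map_add, map_smul, ContinuousLinearEquiv.symm_apply_apply,
      Finset.sum_add_distrib, neg_smul, map_neg, Finset.sum_neg_distrib, b.sum_repr]
    congr 1
    conv_rhs => rw [← b.sum_repr ((leftEquiv x).symm (X x))]
    simp only [map_sum, map_smul, LinearMap.sum_apply, LinearMap.smul_apply]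
  simp only [h2, map_sum, map_add, map_smul, ContinuousLinearEquiv.symm_apply_apply, h3,
    Finset.sum_add_distrib, smul_add, smul_neg, Finset.sum_neg_distrib, b.sum_repr]
  rw [← add_assoc, ← sub_eq_add_neg]
  congr 2
  · conv_rhs => rw [congrFun (hsum Y) x]
    simp only [map_sum, map_smul]
  · conv_rhs => rw [← b.sum_repr ((leftEquiv x).symm (Y x))]
    simp only [map_sum, map_smul]

end Formula
end LieGroupTrivialization

/-! ### The derivative of the adjoint action, and flows of left-invariant fields -/

namespace LieGroupTrivialization

open Bundle VectorField Filter
open scoped Topology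

/-- A charted space over `E` is T1, and a T1 topological group is Hausdorff. Uniqueness of integral
curves needs this. -/
theorem t2Space_of_lieGroup (E : Type*) [NormedAddCommGroup E] [NormedSpace ℝ E]
    (G : Type*) [TopologicalSpace G] [ChartedSpace E G] [Group G] [LieGroup 𝓘(ℝ, E) ∞ G] :
    T2Space G := by
  have := ChartedSpace.t1Space E G
  have := topologicalGroup_of_lieGroup (G := G) 𝓘(ℝ, E) ∞
  infer_instance

variable {E : Type*} [NormedAddCommGroup E] [NormedSpace ℝ E]
  {G : Type*} [TopologicalSpace G] [ChartedSpace E G] [Group G] [LieGroup 𝓘(ℝ, E) ∞ G]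

theorem mdifferentiableAt_adInv (v : E) (x : G) :
    MDifferentiableAt 𝓘(ℝ, E) 𝓘(ℝ, E) (fun y : G => adInv y v) x :=
  (contMDiffAt_leftEquiv_symm (n := ∞) (by simp)
    (contMDiff_modelDeriv_mul_right v).contMDiffAt).mdifferentiableAt (by simp)

/-- The adjoint action as a continuous linear equivalence. -/
noncomputable def adInvEquiv (g : G) : E ≃L[ℝ] E :=
  ContinuousLinearEquiv.equivOfInverse
    ((leftEquiv g).symm.toContinuousLinearMap.comp (modelDeriv (fun y : G => y * g) 1))
    ((leftEquiv g⁻¹).symm.toContinuousLinearMap.comp (modelDeriv (fun y : G => y * g⁻¹) 1))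
    (fun v => by
      have := adInv_mul (E := E) g g⁻¹ v
      rw [mul_inv_cancel, adInv_one] at this
      exact this.symm)
    (fun v => by
      have := adInv_mul (E := E) g⁻¹ g v
      rw [inv_mul_cancel, adInv_one] at this
      exact this.symm)

section Derivative

variable [CompleteSpace E] [FiniteDimensional ℝ E]

/-- The right-invariant field of `w` has left coordinate `adInv y w` and commutes at 1 with the
left-invariant field of `v`; the bracket formula then reads `0 = D(adInv · w)(v) + [v, w]`. -/
theorem modelDeriv_adInv_one (v w : E) :
    modelDeriv (fun y : G => adInv y w) 1 v = -lieBilin G v w := by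
  have h := leftEquiv_symm_modelBracket (G := G) (x := 1) (X := fun y => leftEquiv y v)
    (Y := fun y => modelDeriv (fun z => z * y) 1 w)
    (by simpa only [ContinuousLinearEquiv.symm_apply_apply] using mdifferentiableAt_const)
    (mdifferentiableAt_adInv w 1)
  rw [modelBracket_leftEquiv_modelDeriv_mul_right, map_zero] at h
  have hconst : modelDeriv (fun _ : G => v) 1 = (0 : E →L[ℝ] E) := mfderiv_const
  simp only [ContinuousLinearEquiv.symm_apply_apply, hconst, leftEquiv_one, mul_one, modelDeriv_id,
    ContinuousLinearMap.id_apply, ContinuousLinearEquiv.refl_apply, sub_zero,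
    zero_apply, ContinuousLinearEquiv.refl_symm] at h
  exact eq_neg_of_add_eq_zero_left h.symm

theorem modelDeriv_adInv (g : G) (v w : E) :
    modelDeriv (fun y : G => adInv y w) g (leftEquiv g v) = -lieBilin G v (adInv g w) := by
  rw [← modelDeriv_adInv_one]
  have h := modelDeriv_comp (f := fun y : G => adInv y w) (g := fun y : G => g * y) (x := 1)
    (mdifferentiableAt_adInv w _) (mdifferentiableAt_mul_left (E := E) g 1)
  simp only [adInv_mul, mul_one] at h
  exact (DFunLike.congr_fun h v).symm

theorem hasDerivAt_adInv_integralCurve {γ : ℝ → G} {v : E} {ε t : ℝ}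
    (hγ : IsMIntegralCurveOn (I := 𝓘(ℝ, E)) γ (fun x => leftEquiv (E := E) x v) (Set.Ioo (-ε) ε))
    (ht : t ∈ Set.Ioo (-ε) ε) (w : E) :
    HasDerivAt (fun s => adInv (γ s) w) (-lieBilin G v (adInv (γ t) w)) t := by
  have h1 := (hγ t ht).hasMFDerivAt (Ioo_mem_nhds ht.1 ht.2)
  have h2 := (mdifferentiableAt_adInv (E := E) w (γ t)).hasMFDerivAt.comp t h1
  have h3 : HasFDerivAt (fun s => adInv (γ s) w)
      ((modelDeriv (E := E) (fun y : G => adInv y w) (γ t)).comp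
        ((1 : ℝ →L[ℝ] ℝ).smulRight (leftEquiv (γ t) v))) t := hasMFDerivAt_iff_hasFDerivAt.1 h2
  rw [← modelDeriv_adInv]
  convert! h3.hasDerivAt using 1
  simp

end Derivative

section Flow

theorem isMIntegralCurveOn_mul_left {γ : ℝ → G} {v : E} {s : Set ℝ}
    (hγ : IsMIntegralCurveOn (I := 𝓘(ℝ, E)) γ (fun x => leftEquiv (E := E) x v) s) (a : G) :
    IsMIntegralCurveOn (I := 𝓘(ℝ, E)) (fun t => a * γ t) (fun x => leftEquiv (E := E) x v) s := by
  intro t ht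
  have h := (mdifferentiableAt_mul_left (E := E) a (γ t)).hasMFDerivAt.comp_hasMFDerivWithinAt t
    (hγ t ht)
  have key : (1 : ℝ →L[ℝ] ℝ).smulRight (leftEquiv (E := E) (a * γ t) v) =
      (modelDeriv (E := E) (fun y : G => a * y) (γ t)).comp
        ((1 : ℝ →L[ℝ] ℝ).smulRight (leftEquiv (γ t) v)) := by
    ext
    simp [modelDeriv_mul_left_leftEquiv]
  have hcongr : ∀ L L' : ℝ →L[ℝ] E, L = L' →
      HasMFDerivWithinAt 𝓘(ℝ, ℝ) 𝓘(ℝ, E) (fun t => a * γ t) s t L' →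
      HasMFDerivWithinAt 𝓘(ℝ, ℝ) 𝓘(ℝ, E) (fun t => a * γ t) s t L := by
    rintro _ _ rfl h
    exact h
  exact hcongr _ _ key h

/-- Left translates of integral curves are integral curves, so uniqueness makes any two of them left
translates of each other. The flow is thus right translation by an element independent of the
starting point. -/
theorem integralCurve_eq_mul [CompleteSpace E] {γ γ' : ℝ → G} {v : E} {ε : ℝ} (hε : 0 < ε)
    (hγ : IsMIntegralCurveOn (I := 𝓘(ℝ, E)) γ (fun x => leftEquiv (E := E) x v) (Set.Ioo (-ε) ε))
    (hγ' : IsMIntegralCurveOn (I := 𝓘(ℝ, E)) γ' (fun x => leftEquiv (E := E) x v) (Set.Ioo (-ε) ε))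
    {t : ℝ} (ht : t ∈ Set.Ioo (-ε) ε) : γ t = γ 0 * ((γ' 0)⁻¹ * γ' t) := by
  have := t2Space_of_lieGroup E G
  refine isMIntegralCurveOn_Ioo_eqOn_of_contMDiff_boundaryless (I := 𝓘(ℝ, E)) (t₀ := 0)
    (γ' := fun t => γ 0 * ((γ' 0)⁻¹ * γ' t)) ⟨by linarith, hε⟩
    ((contMDiff_leftEquiv v).of_le (by simp)) hγ
    (isMIntegralCurveOn_mul_left (isMIntegralCurveOn_mul_left hγ' _) _) ?_ ht
  simp

theorem exists_integralCurve_one [CompleteSpace E] (v : E) : ∃ ε > 0, ∃ γ : ℝ → G, γ 0 = 1 ∧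
    IsMIntegralCurveOn (I := 𝓘(ℝ, E)) γ (fun x => leftEquiv (E := E) x v) (Set.Ioo (-ε) ε) := by
  obtain ⟨γ, h0, hγ⟩ := exists_isMIntegralCurveAt_of_contMDiffAt_boundaryless (I := 𝓘(ℝ, E)) (0 : ℝ)
    (((contMDiff_leftEquiv (G := G) v).of_le (n := ∞) (m := 1) (by simp)).contMDiffAt (x := 1))
  obtain ⟨ε, hε, h⟩ := isMIntegralCurveAt_iff'.1 hγ
  refine ⟨ε, hε, γ, h0, ?_⟩
  rwa [Real.ball_eq_Ioo, zero_sub, zero_add] at h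

end Flow
end LieGroupTrivialization

/-! ### Left-invariant `GN`-structures and the Kundt conditions -/

namespace KundtStructures

open LieGroupTrivialization Filter
open scoped Topology

theorem eta_kVec_map_GN {m : ℕ} {f : Space m ≃L[ℝ] Space m} (hf : f ∈ GN m) (z : Space m) :
    (f z) 1 = 0 ↔ z 1 = 0 := by
  obtain ⟨c, hc, -, h⟩ := IsGN.exists_scale hf
  have := h z
  rw [eta_kVec, eta_kVec] at this
  rw [← this, mul_eq_zero, or_iff_right hc]

variable {m : ℕ} {G : Type*} [TopologicalSpace G] [ChartedSpace (Space m) G] [Group G]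
  [LieGroup (𝓡 (m + 2)) ∞ G]

variable (G) in
/-- The left-invariant `GN`-structure spanned by a frame `e` of the Lie algebra. -/
noncomputable def leftInvariantStructure (e : Space m ≃L[ℝ] Space m) : GNStructure m G where
  fibre x := {u | ∃ a ∈ GN m, ∀ v, u v = leftEquiv (E := Space m) x (e (a v))}
  mem_fibre_iff := by
    rintro x u ⟨a, ha, hu⟩ u'
    constructor
    · rintro ⟨a', ha', hu'⟩
      refine ⟨a⁻¹ * a', mul_mem (inv_mem ha) ha', fun v => ?_⟩
      rw [hu, hu']
      congr 2
      exact (a.apply_symm_apply (a' v)).symm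
    · rintro ⟨b, hb, hu'⟩
      exact ⟨a * b, mul_mem ha hb, fun v => (hu' v).trans (hu _)⟩
  exists_section p := by
    refine ⟨Set.univ, isOpen_univ, Set.mem_univ p,
      fun x => e.trans (leftEquiv (E := Space m) x), fun x _ => ?_, fun v => ?_⟩
    · exact ⟨1, one_mem _, fun v => rfl⟩
    · exact (contMDiff_leftEquiv (E := Space m) (e v)).contMDiffOn

theorem mem_nullPerp_leftInvariantStructure {e : Space m ≃L[ℝ] Space m} {x : G} {v : Space m} :
    v ∈ (leftInvariantStructure G e).nullPerp x ↔ (e.symm ((leftEquiv x).symm v)) 1 = 0 := by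
  constructor
  · rintro ⟨u, ⟨a, ha, hu⟩, w, hw, hv⟩
    rw [eta_kVec] at hw
    have h : v = leftEquiv (E := Space m) x (e (a w)) := hv.trans (hu w)
    rw [h, ContinuousLinearEquiv.symm_apply_apply, ContinuousLinearEquiv.symm_apply_apply]
    exact (eta_kVec_map_GN ha w).2 hw
  · intro h
    refine ⟨e.trans (leftEquiv (E := Space m) x), ⟨1, one_mem _, fun v => rfl⟩,
      e.symm ((leftEquiv x).symm v), ?_, ?_⟩
    · rwa [eta_kVec]
    · change v = leftEquiv (E := Space m) x (e (e.symm ((leftEquiv x).symm v)))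
      simp

theorem isLeftInvariant_leftInvariantStructure (e : Space m ≃L[ℝ] Space m) :
    (leftInvariantStructure G e).IsLeftInvariant := by
  rintro b x u ⟨a, ha, hu⟩
  refine ⟨(a.trans e).trans (leftEquiv (E := Space m) (b * x)), ⟨a, ha, fun v => rfl⟩, fun v => ?_⟩
  rw [hu]
  exact (modelDeriv_mul_left_leftEquiv (E := Space m) b x (e (a v))).symm

/-- Sections of Λ have left coordinates in one fixed hyperplane, so the derivatives of these
coordinates stay in it; only the algebraic term of the bracket formula needs the subalgebra
hypothesis. -/
theorem isIntegrable_leftInvariantStructure {e : Space m ≃L[ℝ] Space m}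
    (h : ∀ v w, (e.symm v) 1 = 0 → (e.symm w) 1 = 0 → (e.symm (lieBilin G v w)) 1 = 0) :
    (leftInvariantStructure G e).IsIntegrable := by
  intro U hU X Y hX hY hXU hYU x hx
  have hd : ∀ {Z : G → Space m}, SmoothFieldOn (m := m) (M := G) Z U →
      MDifferentiableAt 𝓘(ℝ, Space m) 𝓘(ℝ, Space m) (fun y => (leftEquiv y).symm (Z y)) x :=
    fun hZ => (contMDiffAt_leftEquiv_symm (n := ∞) (by simp)
      (hZ.contMDiffAt (hU.mem_nhds hx))).mdifferentiableAt (by simp)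
  let φ : Space m →L[ℝ] ℝ :=
    (EuclideanSpace.proj (1 : Fin (m + 2))).comp e.symm.toContinuousLinearMap
  have hzero : ∀ {Z : G → Space m} (_ : SmoothFieldOn (m := m) (M := G) Z U)
      (_ : ∀ y ∈ U, Z y ∈ (leftInvariantStructure G e).nullPerp y) (w : Space m),
      (e.symm (modelDeriv (fun y => (leftEquiv y).symm (Z y)) x w)) 1 = 0 := by
    intro Z hZ hZU w
    have h1 := (φ.hasMFDerivAt (x := (leftEquiv x).symm (Z x))).comp x (hd hZ).hasMFDerivAt
    have h2 : φ ∘ (fun y => (leftEquiv y).symm (Z y)) =ᶠ[𝓝 x] fun _ => 0 := by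
      filter_upwards [hU.mem_nhds hx] with y hy
      exact mem_nullPerp_leftInvariantStructure.1 (hZU y hy)
    have h3 := h1.mfderiv.symm.trans (h2.mfderiv_eq.trans mfderiv_const)
    exact DFunLike.congr_fun h3 w
  have hb := leftEquiv_symm_modelBracket (hd hX) (hd hY)
  refine mem_nullPerp_leftInvariantStructure.2 ?_
  have hlin : ∀ a b c d : Space m, a = b - c + d → (e.symm b) 1 = 0 → (e.symm c) 1 = 0 →
      (e.symm d) 1 = 0 → (e.symm a) 1 = 0 := by
    rintro _ b c d rfl hb hc hd
    simp [hb, hc, hd]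
  exact hlin _ _ _ _ hb (hzero hY hYU _) (hzero hX hXU _)
    (h _ _ (mem_nullPerp_leftInvariantStructure.1 (hXU x hx))
      (mem_nullPerp_leftInvariantStructure.1 (hYU x hx)))

/-- Right translation by `g` acts on left coordinates by `adInv g`, so it preserves the structure
once this map, written in the frame `e`, is in `GN`. -/
theorem mapsFibre_leftInvariantStructure {e : Space m ≃L[ℝ] Space m} {φ : G → G} {x g : G}
    (hφ : φ =ᶠ[𝓝 x] fun y => y * g) (hg : (e.trans (adInvEquiv g)).trans e.symm ∈ GN m) :
    (leftInvariantStructure G e).MapsFibre φ x := by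
  rintro u ⟨a, ha, hu⟩
  refine ⟨((a.trans e).trans (adInvEquiv g)).trans (leftEquiv (E := Space m) (φ x)),
    ⟨(e.trans (adInvEquiv g)).trans e.symm * a, mul_mem hg ha, fun v => ?_⟩, fun v => ?_⟩
  · change leftEquiv (E := Space m) (φ x) (adInvEquiv g (e (a v))) =
      leftEquiv (E := Space m) (φ x) (e (e.symm (adInvEquiv g (e (a v)))))
    rw [e.apply_symm_apply]
  · have h1 : modelDeriv (E := Space m) φ x = modelDeriv (fun y => y * g) x := hφ.mfderiv_eq
    rw [hu]
    change leftEquiv (E := Space m) (φ x) (adInv g (e (a v))) =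
      modelDeriv (E := Space m) φ x (leftEquiv (E := Space m) x (e (a v)))
    rw [h1, modelDeriv_mul_right_leftEquiv, hφ.self_of_nhds]

/-- If `ad k` maps `ℝⁿ` to `k^⊥` and `k^⊥` to `ℝk`, the adjoint action along the integral curve
of `k` belongs to `GN`. -/
theorem adInvEquiv_mem_GN {e : Space m ≃L[ℝ] Space m}
    (h1 : ∀ z, (e.symm (lieBilin G (e (kVec m)) z)) 1 = 0)
    (h2 : ∀ z, (e.symm z) 1 = 0 → ∀ i ≠ 0, (e.symm (lieBilin G (e (kVec m)) z)) i = 0)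
    {γ : ℝ → G} {ε t : ℝ} (h0 : γ 0 = 1)
    (hγ : IsMIntegralCurveOn (I := 𝓡 (m + 2)) γ
      (fun x => leftEquiv (E := Space m) x (e (kVec m))) (Set.Ioo (-ε) ε))
    (ht : t ∈ Set.Ioo (-ε) ε) : (e.trans (adInvEquiv (γ t))).trans e.symm ∈ GN m := by
  have hder : ∀ z i, ∀ s ∈ Set.Ioo (-ε) ε, HasDerivAt (fun s => (e.symm (adInv (γ s) z)) i)
      (-(e.symm (lieBilin G (e (kVec m)) (adInv (γ s) z))) i) s := by
    intro z i s hs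
    let φ : Space m →L[ℝ] ℝ := (EuclideanSpace.proj i).comp e.symm.toContinuousLinearMap
    have := φ.hasFDerivAt.comp_hasDerivAt s (hasDerivAt_adInv_integralCurve hγ hs z)
    simpa [φ] using! this
  have hε : (0 : ℝ) ∈ Set.Ioo (-ε) ε := by
    have := ht.1.trans ht.2
    exact ⟨by linarith, by linarith⟩
  -- The curve `adInv (γ s) z` solves `y' = -[k, y]`, so a coordinate that `ad k` annihilates along
  -- the curve is conserved.
  have hconst : ∀ z i, (∀ s ∈ Set.Ioo (-ε) ε,
      (e.symm (lieBilin G (e (kVec m)) (adInv (γ s) z))) i = 0) → ∀ s ∈ Set.Ioo (-ε) ε,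
      (e.symm (adInv (γ s) z)) i = (e.symm z) i := by
    intro z i hz s hs
    have := isOpen_Ioo.is_const_of_deriv_eq_zero isPreconnected_Ioo
      (fun r hr => (hder z i r hr).differentiableAt.differentiableWithinAt)
      (fun r hr => by rw [(hder z i r hr).deriv, hz r hr, neg_zero]; rfl) hs hε
    rwa [h0, adInv_one] at this
  have hc1 : ∀ z, ∀ s ∈ Set.Ioo (-ε) ε, (e.symm (adInv (γ s) z)) 1 = (e.symm z) 1 :=
    fun z => hconst z 1 fun s _ => h1 _
  have hci : ∀ z, (e.symm z) 1 = 0 → ∀ i ≠ 0, ∀ s ∈ Set.Ioo (-ε) ε,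
      (e.symm (adInv (γ s) z)) i = (e.symm z) i :=
    fun z hz i hi => hconst z i fun s hs => h2 _ ((hc1 z s hs).trans hz) i hi
  -- First all coordinates but that along `k` are conserved, so the image of `k` stays a multiple of
  -- `k`; then `[k, ck] = 0` conserves the remaining one.
  have hk : ∀ s ∈ Set.Ioo (-ε) ε, adInv (γ s) (e (kVec m)) = e (kVec m) := by
    have hk1 : (e.symm (e (kVec m))) 1 = 0 := by simp [kVec]
    have hmul : ∀ s ∈ Set.Ioo (-ε) ε, ∃ c : ℝ, adInv (γ s) (e (kVec m)) = c • e (kVec m) := by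
      intro s hs
      refine ⟨(e.symm (adInv (γ s) (e (kVec m)))) 0, ?_⟩
      apply e.symm.injective
      ext i
      rcases eq_or_ne i 0 with rfl | hi
      · simp [kVec]
      · rw [hci _ hk1 i hi s hs]
        simp [kVec, hi]
    intro s hs
    apply e.symm.injective
    ext i
    refine hconst _ i (fun r hr => ?_) s hs
    obtain ⟨c, hc⟩ := hmul r hr
    rw [hc, map_smul, lieBilin_self]
    simp
  have happ : ∀ z, ((e.trans (adInvEquiv (γ t))).trans e.symm) z = e.symm (adInv (γ t) (e z)) :=
    fun z => rfl
  refine ⟨⟨1, ?_⟩, fun w w' hw hw' => ?_, fun z => ?_⟩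
  · rw [happ, hk t ht, e.symm_apply_apply, one_smul]
  · rw [eta_kVec] at hw hw'
    have key : ∀ w : Space m, w 1 = 0 → ∀ i ≠ 0, (e.symm (adInv (γ t) (e w))) i = w i := by
      intro w hw i hi
      rw [hci (e w) (by rwa [e.symm_apply_apply]) i hi t ht, e.symm_apply_apply]
    -- On `k^⊥` the coordinate along `k`, the only one that may change, enters `eta` only multiplied
    -- by a vanishing coordinate 1.
    rw [happ, happ, eta, eta, key w hw 1 (by simp), key w' hw' 1 (by simp), hw, hw']
    simp only [mul_zero, zero_mul, zero_add]
    refine Finset.sum_congr rfl fun i _ => ?_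
    rw [key w hw _ (Fin.succ_ne_zero _), key w' hw' _ (Fin.succ_ne_zero _)]
  · rw [happ, happ, hk t ht, e.symm_apply_apply, eta_kVec, eta_kVec, hc1 _ t ht,
      e.symm_apply_apply]

theorem isKundt_leftInvariantStructure {e : Space m ≃L[ℝ] Space m}
    (hint : ∀ v w, (e.symm v) 1 = 0 → (e.symm w) 1 = 0 → (e.symm (lieBilin G v w)) 1 = 0)
    (h1 : ∀ z, (e.symm (lieBilin G (e (kVec m)) z)) 1 = 0)
    (h2 : ∀ z, (e.symm z) 1 = 0 → ∀ i ≠ 0, (e.symm (lieBilin G (e (kVec m)) z)) i = 0) :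
    (leftInvariantStructure G e).IsKundt := by
  refine ⟨isIntegrable_leftInvariantStructure hint, fun p => ⟨Set.univ, isOpen_univ, Set.mem_univ p,
    fun x => leftEquiv (E := Space m) x (e (kVec m)),
    (contMDiff_leftEquiv (E := Space m) (e (kVec m))).contMDiffOn, fun x _ => ⟨?_, ?_⟩, ?_, ?_⟩⟩
  · refine ⟨e.trans (leftEquiv (E := Space m) x), ⟨1, one_mem _, fun v => rfl⟩, 1, ?_⟩
    rw [one_smul]
    rfl
  · have hk : kVec m ≠ 0 := by simp [kVec]
    have he : e (kVec m) ≠ 0 := e.map_ne_zero_iff.2 hk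
    exact (leftEquiv (E := Space m) x).map_ne_zero_iff.2 he
  · intro q _
    obtain ⟨ε, hε, γ, h0, hγ⟩ := exists_integralCurve_one (G := G) (e (kVec m))
    exact ⟨Set.univ, ε, fun t x => x * γ t, Set.mem_univ q, isOpen_univ, hε,
      fun x _ => by rw [h0, mul_one], fun _ _ _ _ => Set.mem_univ _,
      fun x _ => isMIntegralCurveOn_mul_left hγ x⟩
  · intro V ε Φ hΦ t ht x hx
    have hγ := isMIntegralCurveOn_mul_left (E := Space m) (hΦ.integralCurve x hx) x⁻¹
    have hGN : (e.trans (adInvEquiv (E := Space m) (x⁻¹ * Φ t x))).trans e.symm ∈ GN m :=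
      adInvEquiv_mem_GN (γ := fun t => x⁻¹ * Φ t x) h1 h2
        (by rw [hΦ.zero x hx, inv_mul_cancel]) hγ ht
    -- Near `x` the given local flow agrees with right translation by the fixed element `x⁻¹ * Φ t
    -- x`.
    refine mapsFibre_leftInvariantStructure (g := x⁻¹ * Φ t x) ?_ hGN
    filter_upwards [hΦ.isOpen.mem_nhds hx] with y hy
    have := integralCurve_eq_mul (E := Space m) hΦ.pos (hΦ.integralCurve y hy)
      (hΦ.integralCurve x hx) ht
    rwa [hΦ.zero y hy, hΦ.zero x hx] at this

/-- The null hyperplane of a left-invariant integrable `GN`-structure is a subalgebra. -/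
theorem GNStructure.exists_subalgebra_of_isIntegrable {P : GNStructure m G} (hP : P.IsLeftInvariant)
    (hint : P.IsIntegrable) : ∃ e : Space m ≃L[ℝ] Space m,
    ∀ v w, (e.symm v) 1 = 0 → (e.symm w) 1 = 0 → (e.symm (lieBilin G v w)) 1 = 0 := by
  obtain ⟨U, -, hU, s, hs, -⟩ := P.exists_section 1
  let e : Space m ≃L[ℝ] Space m := s 1
  have he : (e : Frame m (1 : G)) ∈ P.fibre 1 := hs 1 hU
  have hcongr : ∀ {x y : G} (_ : x = y) {v : Space m}, v ∈ P.nullPerp x → v ∈ P.nullPerp y := by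
    rintro x _ rfl v h
    exact h
  -- Left invariance of `P` spreads the hyperplane at 1 over `G`, so left-invariant extensions of
  -- its vectors are global sections of Λ.
  have hleft : ∀ (x : G) (v : Space m), (e.symm v) 1 = 0 →
      leftEquiv (E := Space m) x v ∈ P.nullPerp x := by
    intro x v hv
    obtain ⟨u', hu', h⟩ := hP x 1 e he
    refine hcongr (mul_one x) ⟨u', hu', e.symm v, by rwa [eta_kVec], ?_⟩
    refine Eq.trans ?_ (h (e.symm v)).symm
    change _ = modelDeriv (E := Space m) (fun y => x * y) 1 (e (e.symm v))
    rw [e.apply_symm_apply]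
    rfl
  have hperp : ∀ v : Space m, v ∈ P.nullPerp (1 : G) → (e.symm v) 1 = 0 := by
    rintro v ⟨u, hu, w, hw, hv⟩
    obtain ⟨a, ha, h⟩ := (P.mem_fibre_iff 1 e he u).1 hu
    rw [eta_kVec] at hw
    have hv' : v = e (a w) := hv.trans (h w)
    rw [hv', e.symm_apply_apply]
    exact (eta_kVec_map_GN ha w).2 hw
  refine ⟨e, fun v w hv hw => hperp _ ?_⟩
  exact hint Set.univ isOpen_univ (fun x => leftEquiv (E := Space m) x v)
    (fun x => leftEquiv (E := Space m) x w) (contMDiff_leftEquiv (E := Space m) v).contMDiffOn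
    (contMDiff_leftEquiv (E := Space m) w).contMDiffOn (fun x _ => hleft x v hv)
    (fun x _ => hleft x w hw) 1 (Set.mem_univ _)

/-- The hyperplane spanned by all vectors of a frame except the second. -/
noncomputable def frameHyperplane (e : Space m ≃L[ℝ] Space m) : Submodule ℝ (Space m) :=
  LinearMap.ker ((EuclideanSpace.proj (𝕜 := ℝ) (1 : Fin (m + 2))).toLinearMap.comp
    e.symm.toLinearMap)

/-- The hyperplane subalgebra of the Lie algebra of `G` given by a frame. -/
noncomputable def hyperplaneSubalgebra (e : Space m ≃L[ℝ] Space m)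
    (h : ∀ v w, (e.symm v) 1 = 0 → (e.symm w) 1 = 0 → (e.symm (lieBilin G v w)) 1 = 0) :
    LieSubalgebra ℝ (GroupLieAlgebra (𝓡 (m + 2)) G) where
  carrier := (frameHyperplane e : Set (Space m))
  zero_mem' := (frameHyperplane e).zero_mem
  add_mem' hv hw := (frameHyperplane e).add_mem hv hw
  smul_mem' c _ hv := (frameHyperplane e).smul_mem c hv
  lie_mem' hv hw := h _ _ hv hw

theorem finrank_hyperplaneSubalgebra (e : Space m ≃L[ℝ] Space m)
    (h : ∀ v w, (e.symm v) 1 = 0 → (e.symm w) 1 = 0 → (e.symm (lieBilin G v w)) 1 = 0) :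
    Module.finrank ℝ (hyperplaneSubalgebra e h) = m + 1 := by
  let φ : Space m →ₗ[ℝ] ℝ :=
    (EuclideanSpace.proj (𝕜 := ℝ) (1 : Fin (m + 2))).toLinearMap.comp e.symm.toLinearMap
  have hφ : Function.Surjective φ := fun c => ⟨e (EuclideanSpace.single 1 c), by
    change (e.symm (e (EuclideanSpace.single 1 c))) 1 = c
    simp⟩
  have h1 := φ.finrank_range_add_finrank_ker
  rw [LinearMap.range_eq_top.2 hφ, finrank_top, Module.finrank_self, finrank_euclideanSpace,
    Fintype.card_fin] at h1
  have h2 : Module.finrank ℝ (hyperplaneSubalgebra e h) = Module.finrank ℝ (LinearMap.ker φ) := rfl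
  omega

end KundtStructures

/-! ### 𝔰𝔲(2) as ℝ³ with the cross product -/

namespace ThreeDimLieAlgebra

section Su2

/-- Coordinates on `𝔰𝔲(2)`. -/
noncomputable def su2Coord : su2 ≃ₗ[ℝ] (Fin 3 → ℝ) where
  -- The factor 2 turns the commutator into exactly the cross product.
  toFun A := ![2 * (A.1 0 0).im, 2 * (A.1 0 1).re, 2 * (A.1 0 1).im]
  map_add' A B := by
    ext i
    fin_cases i <;> simp <;> ring
  map_smul' c A := by
    ext i
    fin_cases i <;> simp <;> ring
  invFun x := ⟨!![⟨0, x 0 / 2⟩, ⟨x 1 / 2, x 2 / 2⟩; ⟨-(x 1 / 2), x 2 / 2⟩, ⟨0, -(x 0 / 2)⟩], by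
    refine ⟨?_, ?_⟩
    · ext i j
      fin_cases i <;> fin_cases j <;> simp [Complex.ext_iff]
    · simp [Matrix.trace_fin_two, Complex.ext_iff]⟩
  left_inv A := by
    obtain ⟨A, hA, hT⟩ := A
    have h00 := congrFun (congrFun hA 0) 0
    have h01 := congrFun (congrFun hA 1) 0
    simp [Complex.ext_iff, Matrix.trace_fin_two] at h00 h01 hT
    obtain ⟨h01, h01'⟩ := h01
    obtain ⟨hT, hT'⟩ := hT
    ext i j
    fin_cases i <;> fin_cases j <;> simp [Complex.ext_iff] <;>
      first | linarith | (constructor <;> linarith)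
  right_inv x := by
    ext i
    fin_cases i <;> simp <;> ring

theorem su2Coord_lie (A B : su2) : su2Coord ⁅A, B⁆ = su2Coord A ⨯₃ su2Coord B := by
  have hb : (⁅A, B⁆ : su2).1 = A.1 * B.1 - B.1 * A.1 := rfl
  obtain ⟨A, hA, hT⟩ := A
  obtain ⟨B, hB, hS⟩ := B
  have hA1 := congrFun (congrFun hA 0) 0
  have hA2 := congrFun (congrFun hA 1) 0
  have hB1 := congrFun (congrFun hB 0) 0
  have hB2 := congrFun (congrFun hB 1) 0
  simp [Complex.ext_iff, Matrix.trace_fin_two] at hA1 hA2 hB1 hB2 hT hS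
  obtain ⟨hT, hT'⟩ := hT
  obtain ⟨hS, hS'⟩ := hS
  obtain ⟨hA2, hA3⟩ := hA2
  obtain ⟨hB2, hB3⟩ := hB2
  have hA1' : (A 0 0).re = 0 := by linarith
  have hB1' : (B 0 0).re = 0 := by linarith
  have hA2' : (A 1 0).re = -(A 0 1).re := by linarith
  have hB2' : (B 1 0).re = -(B 0 1).re := by linarith
  have hA3' : (A 1 0).im = (A 0 1).im := by linarith
  have hB3' : (B 1 0).im = (B 0 1).im := by linarith
  have hA4 : (A 1 1).re = -(A 0 0).re := by linarith
  have hB4 : (B 1 1).re = -(B 0 0).re := by linarith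
  have hA5 : (A 1 1).im = -(A 0 0).im := by linarith
  have hB5 : (B 1 1).im = -(B 0 0).im := by linarith
  ext i
  simp only [su2Coord, LinearEquiv.coe_mk, LinearMap.coe_mk, AddHom.coe_mk, hb, cross_apply]
  fin_cases i <;> simp [Matrix.mul_apply, Fin.sum_univ_two, hA1', hB1', hA2', hB2', hA3', hB3', hA4,
    hB4, hA5, hB5] <;> ring

/-- For a basis of a plane subalgebra, the cross product would lie in the plane and be orthogonal to
it, hence vanish, against linear independence. -/
theorem finrank_subalgebra_su2_ne_two (b : LieSubalgebra ℝ su2) : Module.finrank ℝ b ≠ 2 := by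
  intro hb
  have : Module.Finite ℝ b := Module.finite_of_finrank_pos (by omega)
  let v : Module.Basis (Fin 2) ℝ b := Module.finBasisOfFinrankEq ℝ b hb
  have hli : LinearIndependent ℝ ![su2Coord (v 0), su2Coord (v 1)] := by
    have h := (v.linearIndependent.map' b.toSubmodule.subtype
      (Submodule.ker_subtype _)).map' su2Coord.toLinearMap su2Coord.ker
    have hv : ![su2Coord (v 0), su2Coord (v 1)] =
        ⇑su2Coord.toLinearMap ∘ ⇑b.toSubmodule.subtype ∘ ⇑v := by
      ext i : 1
      fin_cases i <;> rfl
    rw [hv]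
    exact h
  have hne := crossProduct_ne_zero_iff_linearIndependent.2 hli
  apply hne
  rw [← su2Coord_lie]
  have hs : ((⁅v 0, v 1⁆ : b) : su2) = v.repr ⁅v 0, v 1⁆ 0 • (v 0 : su2) +
      v.repr ⁅v 0, v 1⁆ 1 • (v 1 : su2) := by
    have := congrArg (Subtype.val) (v.sum_repr ⁅v 0, v 1⁆)
    rw [Fin.sum_univ_two] at this
    exact this.symm
  rw [LieSubalgebra.coe_bracket] at hs
  have h2 := congrArg su2Coord hs
  rw [map_add, map_smul, map_smul, su2Coord_lie] at h2
  rw [su2Coord_lie, ← dotProduct_self_eq_zero]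
  nth_rewrite 1 [h2]
  simp [add_dotProduct]

end Su2

/-! ### Flag bases of three-dimensional Lie algebras -/

section Unimodular

attribute [local instance 100] LieRing.ofAssociativeRing

variable {L : Type*} [LieRing L] [LieAlgebra ℝ L]

/-- An alternating bilinear map factors through `Λ²`, whose coordinates in dimension 3 are those of
the cross product. -/
theorem lie_eq_sum_cross (v : Module.Basis (Fin 3) ℝ L) (x y : L) :
    ⁅x, y⁆ = (v.equivFun x ⨯₃ v.equivFun y) 0 • ⁅v 1, v 2⁆ +
      (v.equivFun x ⨯₃ v.equivFun y) 1 • ⁅v 2, v 0⁆ +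
      (v.equivFun x ⨯₃ v.equivFun y) 2 • ⁅v 0, v 1⁆ := by
  conv_lhs => rw [← v.sum_equivFun x, ← v.sum_equivFun y]
  simp only [Fin.sum_univ_three, lie_add, add_lie, smul_lie, lie_smul, lie_self, cross_apply,
    smul_zero, Matrix.cons_val]
  rw [← lie_skew (v 0) (v 2), ← lie_skew (v 1) (v 0), ← lie_skew (v 2) (v 1)]
  module

theorem exists_lieEquiv_su2 (v : Module.Basis (Fin 3) ℝ L) (h0 : ⁅v 1, v 2⁆ = v 0)
    (h1 : ⁅v 2, v 0⁆ = v 1) (h2 : ⁅v 0, v 1⁆ = v 2) : Nonempty (L ≃ₗ⁅ℝ⁆ su2) := by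
  have hc : ∀ x y, v.equivFun ⁅x, y⁆ = v.equivFun x ⨯₃ v.equivFun y := by
    intro x y
    apply v.equivFun.symm.injective
    rw [LinearEquiv.symm_apply_apply, lie_eq_sum_cross v, h0, h1, h2, v.equivFun_symm_apply,
      Fin.sum_univ_three]
  exact ⟨{ v.equivFun.trans su2Coord.symm with
    map_lie' := by
      intro x y
      apply su2Coord.injective
      rw [su2Coord_lie]
      simp [hc] }⟩

/-- A basis `k, l, m` such that `ad k` maps the whole Lie algebra to the plane `⟨k, m⟩` and
this plane to the line `⟨k⟩`. -/
def IsFlagBasis (e : Module.Basis (Fin 3) ℝ L) : Prop :=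
  (∃ a : ℝ, ⁅e 0, e 2⁆ = a • e 0) ∧ ∃ c d : ℝ, ⁅e 0, e 1⁆ = c • e 0 + d • e 2

theorem trace_ad_lie (x y : L) : LinearMap.trace ℝ L (LieAlgebra.ad ℝ L ⁅x, y⁆) = 0 := by
  rw [LieHom.map_lie, LieRing.of_associative_ring_bracket, map_sub, LinearMap.trace_mul_comm,
    sub_self]

theorem trace_ad_eq (e : Module.Basis (Fin 3) ℝ L) (x : L) :
    LinearMap.trace ℝ L (LieAlgebra.ad ℝ L x) =
      e.repr ⁅x, e 0⁆ 0 + e.repr ⁅x, e 1⁆ 1 + e.repr ⁅x, e 2⁆ 2 := by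
  rw [LinearMap.trace_eq_matrix_trace ℝ e, Matrix.trace_fin_three]
  simp [LinearMap.toMatrix_apply]

/-- The kernel of `x ↦ tr (ad x)` is a plane containing all brackets. Any basis `k, m` of it works,
with `l = x` outside. -/
theorem exists_flagBasis_of_trace_ne_zero (hL : Module.finrank ℝ L = 3) {x : L}
    (hx : LinearMap.trace ℝ L (LieAlgebra.ad ℝ L x) ≠ 0) :
    ∃ e : Module.Basis (Fin 3) ℝ L, IsFlagBasis e := by
  have : Module.Finite ℝ L := Module.finite_of_finrank_pos (by omega)
  let τ : L →ₗ[ℝ] ℝ := LinearMap.trace ℝ L ∘ₗ (LieAlgebra.ad ℝ L).toLinearMap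
  have hr : Module.finrank ℝ (LinearMap.ker τ) = 2 := by
    have h1 := τ.finrank_range_add_finrank_ker
    have h2 : LinearMap.range τ = ⊤ := by
      rw [LinearMap.range_eq_top]
      intro c
      exact ⟨(c / τ x) • x, by rw [map_smul, smul_eq_mul, div_mul_cancel₀ c (show τ x ≠ 0 from hx)]⟩
    rw [h2, finrank_top, Module.finrank_self] at h1
    omega
  let w := Module.finBasisOfFinrankEq ℝ (LinearMap.ker τ) hr
  have hw : ∀ i, τ (w i) = 0 := fun i => (w i).2
  have hli : LinearIndependent ℝ ![(w 0 : L), x, (w 1 : L)] := by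
    rw [Fintype.linearIndependent_iff]
    intro g hg
    rw [Fin.sum_univ_three] at hg
    simp only [Matrix.cons_val] at hg
    have h1 : g 1 = 0 := by
      have := congrArg τ hg
      rw [map_add, map_add, map_smul, map_smul, map_smul, hw, hw, map_zero, smul_zero, smul_zero,
        zero_add, add_zero, smul_eq_mul] at this
      exact (mul_eq_zero.1 this).resolve_right hx
    have h2 := Fintype.linearIndependent_iff.1
      (w.linearIndependent.map' (LinearMap.ker τ).subtype (Submodule.ker_subtype _))
      ![g 0, g 2] (by
        rw [Fin.sum_univ_two]
        simpa [h1] using hg)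
    intro i
    fin_cases i
    · exact h2 0
    · exact h1
    · exact h2 1
  let e := basisOfLinearIndependentOfCardEqFinrank hli (by simp [hL])
  have he : ⇑e = ![(w 0 : L), x, (w 1 : L)] :=
    coe_basisOfLinearIndependentOfCardEqFinrank hli (by simp [hL])
  have h0 : e 0 = w 0 := by rw [he]; rfl
  have h1 : e 1 = x := by rw [he]; rfl
  have h2 : e 2 = w 1 := by rw [he]; rfl
  have hker : ∀ y, τ y = 0 → e.repr y 1 = 0 := by
    intro y hy
    rw [← e.sum_repr y, Fin.sum_univ_three, map_add, map_add, map_smul, map_smul, map_smul, h0, h1,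
      h2, hw, hw, smul_zero, smul_zero, zero_add, add_zero, smul_eq_mul] at hy
    exact (mul_eq_zero.1 hy).resolve_right hx
  have hexp : ∀ y z : L, ⁅y, z⁆ = e.repr ⁅y, z⁆ 0 • e 0 + e.repr ⁅y, z⁆ 2 • e 2 := by
    intro y z
    conv_lhs => rw [← e.sum_repr ⁅y, z⁆, Fin.sum_univ_three, hker _ (trace_ad_lie y z), zero_smul,
      add_zero]
  refine ⟨e, ⟨e.repr ⁅e 0, e 2⁆ 0, ?_⟩, _, _, hexp _ _⟩
  have hz : e.repr (0 : L) 0 = 0 := by simp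
  have ht0 : τ (e 0) = 0 := by rw [h0, hw]
  -- Since brackets have no `e 1` component, the trace of `ad (e 0)` is the `e 2` coefficient of `[e
  -- 0, e 2]`; it vanishes because `e 0` is in the kernel.
  have ht := trace_ad_eq e (e 0)
  rw [lie_self, hz, hker _ (trace_ad_lie _ _), zero_add, zero_add] at ht
  have : e.repr ⁅e 0, e 2⁆ 2 = 0 := ht.symm.trans ht0
  conv_lhs => rw [hexp, this, zero_smul, add_zero]

/-- A basis in which the bracket is diagonal. -/
def IsDiagonalBasis (f : Module.Basis (Fin 3) ℝ L) (p q r : ℝ) : Prop :=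
  ⁅f 1, f 2⁆ = p • f 0 ∧ ⁅f 2, f 0⁆ = q • f 1 ∧ ⁅f 0, f 1⁆ = r • f 2

/-- In coordinates the bracket is `S (x × y)`, where the vanishing of all `tr (ad x)` makes `S`
symmetric. Orthonormal eigenvectors of `S` diagonalise it. -/
theorem exists_diagonalBasis (hL : Module.finrank ℝ L = 3)
    (hx : ∀ x : L, LinearMap.trace ℝ L (LieAlgebra.ad ℝ L x) = 0) :
    ∃ (f : Module.Basis (Fin 3) ℝ L) (p q r : ℝ), IsDiagonalBasis f p q r := by
  have : Module.Finite ℝ L := Module.finite_of_finrank_pos (by omega)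
  let v := Module.finBasisOfFinrankEq ℝ L hL
  let S : Matrix (Fin 3) (Fin 3) ℝ :=
    fun i j => ![v.repr ⁅v 1, v 2⁆ i, v.repr ⁅v 2, v 0⁆ i, v.repr ⁅v 0, v 1⁆ i] j
  have hS : S.IsHermitian := by
    have t0 := (trace_ad_eq v (v 0)).symm.trans (hx _)
    have t1 := (trace_ad_eq v (v 1)).symm.trans (hx _)
    have t2 := (trace_ad_eq v (v 2)).symm.trans (hx _)
    have hz : ∀ i, v.repr (0 : L) i = 0 := fun i => by simp
    rw [lie_self, hz] at t0 t1 t2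
    have hs : ∀ i j k, v.repr ⁅v i, v j⁆ k = -v.repr ⁅v j, v i⁆ k := by
      intro i j k
      rw [← lie_skew, map_neg, Finsupp.neg_apply]
    rw [hs 0 2] at t0
    rw [hs 1 0] at t1
    rw [hs 2 1] at t2
    apply Matrix.IsHermitian.ext
    intro i j
    rw [star_trivial]
    fin_cases i <;> fin_cases j <;> simp only [S, Fin.zero_eta, Fin.mk_one, Fin.reduceFinMk,
      Matrix.cons_val] <;> linarith
  have hb : ∀ x y : L, v.equivFun ⁅x, y⁆ = S *ᵥ (v.equivFun x ⨯₃ v.equivFun y) := by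
    intro x y
    rw [lie_eq_sum_cross v]
    ext i
    simp [Matrix.mulVec, dotProduct, Fin.sum_univ_three, S]
    ring
  let u : Fin 3 → Fin 3 → ℝ := fun i => (hS.eigenvectorBasis i).ofLp
  have hu : ∀ i, S *ᵥ u i = hS.eigenvalues i • u i := hS.mulVec_eigenvectorBasis
  have hexp : ∀ z : Fin 3 → ℝ, z = (u 0 ⬝ᵥ z) • u 0 + (u 1 ⬝ᵥ z) • u 1 + (u 2 ⬝ᵥ z) • u 2 := by
    intro z
    have h := hS.eigenvectorBasis.sum_repr' (WithLp.toLp 2 z)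
    have h2 := congrArg WithLp.ofLp h
    rw [Fin.sum_univ_three] at h2
    conv_lhs => rw [show z = (WithLp.toLp 2 z).ofLp from rfl, ← h2]
    simp [u, EuclideanSpace.inner_eq_star_dotProduct, dotProduct_comm]
  -- The triple product is kept as a factor, so the orientation of the eigenbasis need not be fixed;
  -- it is absorbed into `p, q, r`.
  have h01 : u 0 ⨯₃ u 1 = (u 0 ⬝ᵥ u 1 ⨯₃ u 2) • u 2 := by
    conv_lhs => rw [hexp (u 0 ⨯₃ u 1)]
    rw [dot_self_cross, dot_cross_self, triple_product_permutation, triple_product_permutation]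
    simp
  have h12 : u 1 ⨯₃ u 2 = (u 0 ⬝ᵥ u 1 ⨯₃ u 2) • u 0 := by
    conv_lhs => rw [hexp (u 1 ⨯₃ u 2)]
    rw [dot_self_cross, dot_cross_self]
    simp
  have h20 : u 2 ⨯₃ u 0 = (u 0 ⬝ᵥ u 1 ⨯₃ u 2) • u 1 := by
    conv_lhs => rw [hexp (u 2 ⨯₃ u 0)]
    rw [dot_self_cross, dot_cross_self, ← triple_product_permutation (u 0)]
    simp
  let f : Module.Basis (Fin 3) ℝ L :=
    (hS.eigenvectorBasis.toBasis.map (WithLp.linearEquiv 2 ℝ (Fin 3 → ℝ))).map v.equivFun.symm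
  have hf : ∀ i, v.equivFun (f i) = u i := by
    intro i
    have : f i = v.equivFun.symm (u i) := by
      simp only [f, Module.Basis.map_apply, OrthonormalBasis.coe_toBasis]
      rfl
    rw [this, LinearEquiv.apply_symm_apply]
  have hmk : ∀ i j k (c : ℝ), u i ⨯₃ u j = c • u k →
      ⁅f i, f j⁆ = (c * hS.eigenvalues k) • f k := by
    intro i j k c h
    apply v.equivFun.injective
    rw [hb, hf, hf, h, Matrix.mulVec_smul, hu, smul_smul, map_smul, hf]
  exact ⟨f, _, _, _, hmk _ _ _ _ h12, hmk _ _ _ _ h20, hmk _ _ _ _ h01⟩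

theorem IsDiagonalBasis.rotate {f : Module.Basis (Fin 3) ℝ L} {p q r : ℝ}
    (h : IsDiagonalBasis f p q r) :
    IsDiagonalBasis (f.reindex (finRotate 3).symm) q r p := by
  simp only [IsDiagonalBasis, Module.Basis.reindex_apply, Equiv.symm_symm]
  exact ⟨h.2.1, h.2.2, h.1⟩

/-- Three linearly independent vectors of a three-dimensional space form a basis. -/
theorem exists_basis_of_forall_eq_zero (hL : Module.finrank ℝ L = 3) (x y z : L)
    (h : ∀ a b c : ℝ, a • x + b • y + c • z = 0 → a = 0 ∧ b = 0 ∧ c = 0) :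
    ∃ e : Module.Basis (Fin 3) ℝ L, e 0 = x ∧ e 1 = y ∧ e 2 = z := by
  have hli : LinearIndependent ℝ ![x, y, z] := by
    rw [Fintype.linearIndependent_iff]
    intro g hg
    rw [Fin.sum_univ_three] at hg
    obtain ⟨h0, h1, h2⟩ := h _ _ _ hg
    intro i
    fin_cases i
    · exact h0
    · exact h1
    · exact h2
  refine ⟨basisOfLinearIndependentOfCardEqFinrank hli (by simp [hL]), ?_⟩
  rw [coe_basisOfLinearIndependentOfCardEqFinrank]
  exact ⟨rfl, rfl, rfl⟩

theorem eq_zero_of_basis_combination (f : Module.Basis (Fin 3) ℝ L) {a b c : ℝ}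
    (h : a • f 0 + b • f 1 + c • f 2 = 0) : a = 0 ∧ b = 0 ∧ c = 0 := by
  have := Fintype.linearIndependent_iff.1 f.linearIndependent ![a, b, c] (by
    rw [Fin.sum_univ_three]
    exact h)
  exact ⟨this 0, this 1, this 2⟩

/-- Here `f 1` and `f 2` commute, so `k = f 1`, `l = f 0`, `m = f 2` will do. -/
theorem IsDiagonalBasis.exists_flagBasis_of_eq_zero (hL : Module.finrank ℝ L = 3)
    {f : Module.Basis (Fin 3) ℝ L} {q r : ℝ} (h : IsDiagonalBasis f 0 q r) :
    ∃ e : Module.Basis (Fin 3) ℝ L, IsFlagBasis e := by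
  obtain ⟨e, h0, h1, h2⟩ := exists_basis_of_forall_eq_zero hL (f 1) (f 0) (f 2) (by
    intro a b c h
    obtain ⟨hb, ha, hc⟩ := eq_zero_of_basis_combination f (a := b) (b := a) (c := c) (by
      rw [← h]
      module)
    exact ⟨ha, hb, hc⟩)
  refine ⟨e, ⟨0, ?_⟩, 0, -r, ?_⟩
  · rw [h0, h2, h.1]
    module
  · rw [h0, h1, h2, ← lie_skew, h.2.2]
    module

/-- On `⟨f 0, f 1⟩` the square of `ad (f 2)` is `-pq > 0`, so it has a real eigenvector `k = t f 0 +
q f 1` with eigenvalue `t = √(-pq)`. Take `l = f 0` and `m = f 2`. -/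
theorem IsDiagonalBasis.exists_flagBasis_of_mul_neg (hL : Module.finrank ℝ L = 3)
    {f : Module.Basis (Fin 3) ℝ L} {p q r : ℝ} (h : IsDiagonalBasis f p q r) (hpq : p * q < 0) :
    ∃ e : Module.Basis (Fin 3) ℝ L, IsFlagBasis e := by
  have hq : q ≠ 0 := right_ne_zero_of_mul hpq.ne
  set t := √(-(p * q)) with ht
  have htt : t * t = -(p * q) := Real.mul_self_sqrt (by linarith)
  obtain ⟨e, h0, h1, h2⟩ := exists_basis_of_forall_eq_zero hL (t • f 0 + q • f 1) (f 0)
    (f 2) (by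
    intro a b c h
    obtain ⟨hb, ha, hc⟩ := eq_zero_of_basis_combination f (a := a * t + b) (b := a * q) (c := c) (by
      rw [← h]
      module)
    have ha := (mul_eq_zero.1 ha).resolve_right hq
    rw [ha, zero_mul, zero_add] at hb
    exact ⟨ha, hb, hc⟩)
  refine ⟨e, ⟨-t, ?_⟩, 0, -(q * r), ?_⟩
  · rw [h0, h2, add_lie, smul_lie, smul_lie, ← lie_skew, h.2.1, h.1, smul_add, smul_smul, smul_smul,
      neg_mul, htt]
    module
  · rw [h0, h1, h2, add_lie, smul_lie, smul_lie, lie_self, ← lie_skew, h.2.2]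
    module

theorem IsDiagonalBasis.exists_lieEquiv_su2 (hL : Module.finrank ℝ L = 3)
    {f : Module.Basis (Fin 3) ℝ L} {p q r : ℝ} (h : IsDiagonalBasis f p q r) (hqr : 0 < q * r)
    (hrp : 0 < r * p) : Nonempty (L ≃ₗ⁅ℝ⁆ su2) := by
  obtain ⟨h0, h1, h2⟩ := h
  set a := √(q * r)
  set b := √(r * p)
  have ha : a ≠ 0 := (Real.sqrt_pos.2 hqr).ne'
  have hb : b ≠ 0 := (Real.sqrt_pos.2 hrp).ne'
  have haa : a * a = q * r := Real.mul_self_sqrt hqr.le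
  have hbb : b * b = r * p := Real.mul_self_sqrt hrp.le
  have hp : p ≠ 0 := right_ne_zero_of_mul hrp.ne'
  -- Scales `α, β, γ` must satisfy `βγp = α`, `γαq = β`, `αβr = γ`, whence `α² = 1/(qr)` and `β² =
  -- 1/(rp)`; after choosing positive roots, the first relation fixes `γ` with its sign.
  obtain ⟨e, e0, e1, e2⟩ := exists_basis_of_forall_eq_zero hL (a⁻¹ • f 0) (b⁻¹ • f 1)
    ((b / (a * p)) • f 2) (by
    intro x y z h
    rw [smul_smul, smul_smul, smul_smul] at h
    obtain ⟨hx, hy, hz⟩ := eq_zero_of_basis_combination f h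
    exact ⟨(mul_eq_zero.1 hx).resolve_right (inv_ne_zero ha),
      (mul_eq_zero.1 hy).resolve_right (inv_ne_zero hb),
      (mul_eq_zero.1 hz).resolve_right (div_ne_zero hb (mul_ne_zero ha hp))⟩)
  apply ThreeDimLieAlgebra.exists_lieEquiv_su2 e
  · rw [e0, e1, e2, smul_lie, lie_smul, h0, smul_smul, smul_smul]
    congr 1
    field_simp
  · rw [e0, e1, e2, smul_lie, lie_smul, h1, smul_smul, smul_smul]
    congr 1
    field_simp
    linear_combination q * hbb - p * haa
  · rw [e0, e1, e2, smul_lie, lie_smul, h2, smul_smul, smul_smul]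
    congr 1
    field_simp
    linear_combination -hbb

theorem exists_flagBasis (hL : Module.finrank ℝ L = 3) (h : IsEmpty (L ≃ₗ⁅ℝ⁆ su2)) :
    ∃ e : Module.Basis (Fin 3) ℝ L, IsFlagBasis e := by
  by_cases hx : ∀ x : L, LinearMap.trace ℝ L (LieAlgebra.ad ℝ L x) = 0
  · obtain ⟨f, p, q, r, hf⟩ := exists_diagonalBasis hL hx
    rcases lt_trichotomy (p * q) 0 with hpq | hpq | hpq
    · exact hf.exists_flagBasis_of_mul_neg hL hpq
    · rcases mul_eq_zero.1 hpq with rfl | rfl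
      · exact hf.exists_flagBasis_of_eq_zero hL
      · exact hf.rotate.exists_flagBasis_of_eq_zero hL
    rcases lt_trichotomy (q * r) 0 with hqr | hqr | hqr
    · exact hf.rotate.exists_flagBasis_of_mul_neg hL hqr
    · rcases mul_eq_zero.1 hqr with rfl | rfl
      · exact hf.rotate.exists_flagBasis_of_eq_zero hL
      · exact hf.rotate.rotate.exists_flagBasis_of_eq_zero hL
    -- All three coefficients have the same sign: `q² (rp) = (pq)(qr)`.
    have hrp : 0 < r * p := by
      have : 0 < q ^ 2 * (r * p) := by nlinarith [mul_pos hpq hqr]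
      exact pos_of_mul_pos_right this (sq_nonneg q)
    exact (not_nonempty_iff.2 h (hf.exists_lieEquiv_su2 hL hqr hrp)).elim
  · obtain ⟨x, hx⟩ := not_forall.1 hx
    exact exists_flagBasis_of_trace_ne_zero hL hx

end Unimodular

end ThreeDimLieAlgebra

/-! ### From flag bases to Kundt structures, and the theorem -/

namespace KundtStructures

open LieGroupTrivialization

/-- The frame given by a basis. -/
theorem exists_frame_of_basis {m : ℕ} (b : Module.Basis (Fin (m + 2)) ℝ (Space m)) :
    ∃ e : Space m ≃L[ℝ] Space m, ∀ z i, (e.symm z) i = b.repr z i :=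
  ⟨(b.equivFun.trans (WithLp.linearEquiv 2 ℝ (Fin (m + 2) → ℝ)).symm).symm.toContinuousLinearEquiv,
    fun _ _ => rfl⟩

section

variable {G : Type*} [TopologicalSpace G] [ChartedSpace (Space 1) G] [Group G]
  [LieGroup (𝓡 (1 + 2)) ∞ G]

/-- With `b` as frame, `k = b 0` and `k^⊥ = ⟨b 0, b 2⟩`. The first relation makes this plane a
subalgebra sent into `ℝk` by `ad k`; the second sends the transversal `b 1` into the plane. -/
theorem exists_kundt_of_flagBasis (b : Module.Basis (Fin 3) ℝ (Space 1)) {a c d : ℝ}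
    (ha : lieBilin G (b 0) (b 2) = a • b 0) (hcd : lieBilin G (b 0) (b 1) = c • b 0 + d • b 2) :
    (∃ h : LieSubalgebra ℝ (GroupLieAlgebra (𝓡 (1 + 2)) G), Module.finrank ℝ h = 2) ∧
      ∃ P : GNStructure 1 G, P.IsLeftInvariant ∧ P.IsKundt := by
  obtain ⟨e, he⟩ := exists_frame_of_basis b
  have hk : e (kVec 1) = b 0 := by
    apply e.symm.injective
    ext i
    rw [e.symm_apply_apply, he, b.repr_self, kVec, Finsupp.single_apply, PiLp.single_apply]
    simp [eq_comm]
  have hexp : ∀ z, (e.symm z) 1 = 0 → z = b.repr z 0 • b 0 + b.repr z 2 • b 2 := by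
    intro z hz
    rw [he] at hz
    conv_lhs => rw [← b.sum_repr z, Fin.sum_univ_three, hz, zero_smul, add_zero]
  have h20 : lieBilin G (b 2) (b 0) = -(a • b 0) := by
    rw [← ha]
    exact (lie_skew (L := GroupLieAlgebra (𝓡 (1 + 2)) G) (b 2) (b 0)).symm
  have hint : ∀ v w, (e.symm v) 1 = 0 → (e.symm w) 1 = 0 → (e.symm (lieBilin G v w)) 1 = 0 := by
    intro v w hv hw
    rw [hexp v hv, hexp w hw, he]
    simp [ha, h20, lieBilin_self]
  have h1 : ∀ z, (e.symm (lieBilin G (e (kVec 1)) z)) 1 = 0 := by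
    intro z
    rw [hk, he, ← b.sum_repr z, Fin.sum_univ_three]
    simp [ha, hcd, lieBilin_self]
  have h2 : ∀ z, (e.symm z) 1 = 0 → ∀ i ≠ 0, (e.symm (lieBilin G (e (kVec 1)) z)) i = 0 := by
    intro z hz i hi
    rw [hk, he, hexp z hz]
    simp [ha, lieBilin_self, hi.symm]
  exact ⟨⟨hyperplaneSubalgebra e hint, finrank_hyperplaneSubalgebra e hint⟩,
    leftInvariantStructure G e, isLeftInvariant_leftInvariantStructure e,
    isKundt_leftInvariantStructure hint h1 h2⟩

end

end KundtStructures

theorem mainTheorem11 :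
    (∀ b : LieSubalgebra ℝ su2, Module.finrank ℝ b ≠ 2) ∧
    ∀ (G : Type*) [TopologicalSpace G] [ChartedSpace (EuclideanSpace ℝ (Fin 3)) G] [Group G]
      [LieGroup (𝓡 3) ∞ G],
      (IsEmpty (GroupLieAlgebra (𝓡 3) G ≃ₗ⁅ℝ⁆ su2) →
        (∃ b : LieSubalgebra ℝ (GroupLieAlgebra (𝓡 3) G), Module.finrank ℝ b = 2) ∧
        ∃ P : KundtStructures.GNStructure 1 G, P.IsLeftInvariant ∧ P.IsKundt) ∧
      (Nonempty (GroupLieAlgebra (𝓡 3) G ≃ₗ⁅ℝ⁆ su2) →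
        ¬ ∃ P : KundtStructures.GNStructure 1 G, P.IsLeftInvariant ∧ P.IsKundt) := by
  refine ⟨ThreeDimLieAlgebra.finrank_subalgebra_su2_ne_two, fun G _ _ _ _ => ⟨fun h => ?_, ?_⟩⟩
  · have hL : Module.finrank ℝ (GroupLieAlgebra (𝓡 3) G) = 3 :=
      finrank_euclideanSpace_fin (𝕜 := ℝ) (n := 3)
    obtain ⟨b, ⟨a, ha⟩, c, d, hcd⟩ := ThreeDimLieAlgebra.exists_flagBasis hL h
    exact KundtStructures.exists_kundt_of_flagBasis (G := G) b ha hcd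
  · rintro ⟨φ⟩ ⟨P, hP, hK⟩
    obtain ⟨e, he⟩ := KundtStructures.GNStructure.exists_subalgebra_of_isIntegrable hP hK.1
    let h := KundtStructures.hyperplaneSubalgebra e he
    have hh : Module.finrank ℝ h = 2 := KundtStructures.finrank_hyperplaneSubalgebra e he
    -- The isomorphism carries the hyperplane subalgebra to a two-dimensional subalgebra of 𝔰𝔲(2).
    apply ThreeDimLieAlgebra.finrank_subalgebra_su2_ne_two (h.map φ.toLieHom)
    exact (LinearEquiv.finrank_map_eq φ.toLinearEquiv h.toSubmodule).trans hh
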